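/- **Conventions.** Throughout $x\cdot\infty=\infty\cdot x=\infty$ for $x\in(0,\infty]$, $e^{-\infty}=0$, and in interpreting $e^{-xy}$ for $x,y\in[0,\infty]$ we use the conventions $0^+\cdot\infty$, $\infty\cdot 0^+$, i.e. $0\cdot\infty=\infty\cdot 0=\infty$; so $e^{-xy}=0$ as soon as $x=\infty$ or $y=\infty$. Put $\mathsf e^y(x):=e^{-xy}$ and let $\mathcal D$ be the linear span of $\{\mathsf e^y:y\in(0,\infty)\}$ in $\mathbb R^{[0,\infty]}$. Also $\inf\emptyset=\infty$, $\mathbb N=\{1,2,\dots\}$ and $f_{0-}:=f_0$. **Laplace symbols and pregenerators.** A Lévy family $l=(l_x)_{x\in[0,\infty]}$ consists of - a triplet $l_0=(\nu_0,d_0,c_0)$, with $\nu_0$ a measure on $(0,\infty)$, $\int(1\wedge u)\,\nu_0(du)<\infty$, $d_0,c_0\ge 0$; - for each $x\in(0,\infty)$ a quadruplet $l_x=(\nu_x,a_x,b_x,c_x)$, depending measurably on $x$, with $\nu_x$ a measure on $[-x,\infty)$, $\nu_x(\{0\})=0$, $\int(1\wedge u^2)\,\nu_x(du)<\infty$, $a_x,c_x\ge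 0$, $b_x\in\mathbb R$; - a pair $l_\infty=(\nu_\infty,k_\infty)$, with $\nu_\infty$ a measure on $(0,\infty)$, $\int e^{-uy}\nu_\infty(du)<\infty$ for all $y>0$, $k_\infty\ge 0$. Its Laplace symbol is the map $\psi_l:[0,\infty]\times(0,\infty)\to\mathbb R$ given by $$\psi_l(0,y)=\int(e^{-uy}-1)\,\nu_0(du)-d_0y-c_0,\qquad \psi_l(\infty,y)=\int e^{-uy}\nu_\infty(du)+k_\infty,$$ $$\psi_l(x,y)=\int\big(e^{-uy}-1+uy\mathbf 1_{[-1,1]}(u)\big)\nu_x(du)+a_xy^2-b_xy-c_x,\quad x\in(0,\infty).$$ A Laplace symbol determines its Lévy family. The associated pregenerator maps $f\in\mathcal D$ to the function with value $\int(f(u)-f(0))\,\nu_0(du)+d_0f'(0)-c_0f(0)$ at $0$, $\int\big(f(x+u)-f(x)-uf'(x)\mathbf 1_{[-1,1]}(u)\big)\nu_x(du)+a_xf''(x)+b_xf'(x)-c_xf(x)$ at $x\in(0,\infty)$, and $\int(f(u)-f(\infty))\,\nu_\infty(du)+k_\infty(f(0)-f(\infty))$ at $\infty$. For $\psi:[0,\infty]^2\to\mathbb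 R$ put $\hat\psi(x,y):=\psi(y,x)$. Then $\psi$ is a *Laplace dual symbol* if $\psi$ and $\hat\psi$ restricted to $[0,\infty]\times(0,\infty)$ are both Laplace symbols; it *vanishes at infinity* if $\psi(x,y)=0$ whenever $x=\infty$ or $y=\infty$. **Processes.** For $b\in\{0,\infty\}$ let $\mathbb D^{\mathrm mb}$ be the set of càdlàg paths $f:[0,\infty)\to[0,\infty]$ such that, with $\zeta_b(f):=\inf\{t:f_{t-}=b\text{ or }f_t=b\}$, one has $f_t=b$ for all real $t\ge\zeta_b(f)$. A path $f\in\mathbb D^{\mathrm m\infty}$ does not explode continuously at $\infty$ if $\zeta_\infty(f)<\infty$ implies $f_{\zeta_\infty(f)-}<\infty$. A solution $(X,\mathbb P)$ of the martingale problem for $(\mathcal A,\mu)$, $\mathcal A$ being an operator on functions on $[0,\infty]$, is a progressively measurable $[0,\infty]$-valued process $X=(X_t)_{t\ge0}$ with $X_0$ of law $\mu$ under $\mathbb P$, such that for each $f$ in the domain of $\mathcal A$ the process $\big(f(X_t)-\int_0^t\mathcal Af(X_s)\,ds\big)_{t\ge0}$ is a martingale in the natural filtration of $X$, the integrals being well-defined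 and finite a.s. If $X$ starts from $x_0$ under $\mathbb P_{x_0}$, then $b\in\{0,\infty\}$ is *non-sticky* for $X$ when, in case $x_0\ne b$, one has $\mathbb P_{x_0}(X_t\neq b)=1$ for all $t\ge0$. **Theorem.** Let $\psi$ be a Laplace dual symbol vanishing at infinity, and let $\mathcal X$ and $\mathcal Y$ be the pregenerators associated to $\psi|_{[0,\infty]\times(0,\infty)}$ and $\hat\psi|_{[0,\infty]\times(0,\infty)}$. Fix $x_0,y_0\in[0,\infty]$. Let $(X,\mathbb P_{x_0})$ and $(Y,\mathbb P^{y_0})$ be $\mathbb D^{\mathrm m\infty}$-valued solutions of the martingale problems for $(\mathcal X,\delta_{x_0})$ and $(\mathcal Y,\delta_{y_0})$, respectively. Put $\phi(x,y):=\psi(x,y)e^{-xy}$ and $\hat\phi(x,y):=\phi(y,x)$ for $x,y\in[0,\infty]$, and let $\mathbb E$ be the expectation of $\mathbb P_{x_0}\times\mathbb P^{y_0}$. Then $$\mathbb E_{x_0}\big[e^{-X_ty_0}\big]=\mathbb E^{y_0}\big[e^{-x_0Y_t}\big]\qquad\text{for all }t\in[0,\infty),$$ provided one of (I)–(IV) below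 holds. There, for random times $\sigma$ (for $X$) and $\tau$ (for $Y$), we refer to the conditions (A) $\int_0^T\int_0^T\mathbb E[\phi_\pm(X_{s\wedge\sigma},Y_{t\wedge\tau})]\mathbf 1_{[0,T]}(s+t)\,ds\,dt<\infty$ for all $T\in[0,\infty)$, with $+$ or with $-$, not necessarily both; (B) $\mathbb E[|\phi(X_\sigma,Y_\tau)|;\sigma+\tau\le t]<\infty$ for a.e. $t\in[0,\infty)$, and the following conditions on a function $\varphi$ (which will be $\phi$ or $\hat\phi$): (a) $\varphi(x,\cdot)$ is continuous at $0$ for all $x\in[0,\infty)$; (b) $\lim_{y\to\infty}\varphi(x,y)=0$ for all $x\in(0,\infty)$; (c) $\sup_{[0,m]^2}|\varphi|<\infty$ for all $m\in[0,\infty)$; (d) $\sup_{[0,m]\times(\epsilon,n)}|\varphi|<\infty$ for all $m,n,\epsilon\in(0,\infty)$; (e) $\varphi(0,\cdot)$ vanishes on $[0,\infty]$. Put $\sigma_m^+:=\inf\{t:X_t>m\}$, $\sigma_\delta^-:=\inf\{t:X_t<\delta\}$, $\tau_n^+:=\inf\{t:Y_t>n\}$, $\tau_\epsilon^-:=\inf\{t:Y_t<\epsilon\}$.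 (I) (A) holds with $\sigma\equiv\infty\equiv\tau$; the process $\big(\mathbf 1_{\{Y_t<\infty\}}-\int_0^t\phi(0,Y_s)\,ds\big)_{t\ge0}$ is a martingale in the natural filtration of $Y$ (the integrals being well-defined and finite a.s.); $0$ is non-sticky for $Y$; $y_0>0$. (II) For all $m,n\in\mathbb N$, (A) and (B) hold with $\sigma=\sigma_m^+$, $\tau=\tau_n^+$; $\phi$ and $\hat\phi$ satisfy (b); $0$ is non-sticky for $X$ and for $Y$; $x_0>0$ and $y_0>0$. (III) For all $n\in\mathbb N$ and $\epsilon\in(0,\infty)$, (A) holds with $\sigma=\infty$, $\tau=\tau_n^+\wedge\tau_\epsilon^-$; $\hat\phi$ satisfies (a) and (e), $\phi$ satisfies (d); $\infty$ is non-sticky for $X$; a.s. $Y$ does not explode continuously at $\infty$; $Y$ is $\mathbb D^{\mathrm m0}$-valued. (IV) For all $\delta,\epsilon\in(0,\infty)$, (A) and (B) hold with $\sigma=\sigma_\delta^-$, $\tau=\tau_\epsilon^-$; $\phi$ satisfies (a), (c) and (e), $\hat\phi$ satisfies (a) and (e); $X$ and $Y$ are $\mathbb D^{\mathrm m0}$-valued;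 $\infty$ is non-sticky for $X$ and for $Y$. -/

import Mathlib

open MeasureTheory ProbabilityTheory Set Filter Topology
open scoped NNReal ENNReal

noncomputable section

namespace LaplaceDuality

/-! ### The exponential kernel -/

/-- `e^{-xy}` on `[0,∞]²` under the conventions `0⁺·∞` and `∞·0⁺`, that is, in the exponent
`0 · ∞ = ∞ · 0 = ∞`, and `e^{-∞} = 0`. -/
def expKernel (x y : ℝ≥0∞) : ℝ :=
  if x = ∞ ∨ y = ∞ then 0 else Real.exp (-(x.toReal * y.toReal))

/-- The linear span `𝒟` of the maps `𝖾^y : [0,∞] → ℝ`, `x ↦ e^{-xy}`, for `y ∈ (0,∞)`. -/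
def expSpan : Submodule ℝ (ℝ≥0∞ → ℝ) :=
  Submodule.span ℝ {f | ∃ y : ℝ≥0∞, 0 < y ∧ y < ∞ ∧ f = fun x => expKernel x y}

/-! ### Lévy families and Laplace symbols -/

/-- An `x`-Lévy quadruplet `(ν, a, b, c)`; `ν` is a measure on `[-x,∞)`, viewed as a measure
on `ℝ` carried by `[-x,∞)`. -/
structure LevyQuadruplet (x : ℝ) where
  ν : Measure ℝ
  a : ℝ
  b : ℝ
  c : ℝ
  ν_carried : ν (Iio (-x)) = 0
  ν_zero : ν {0} = 0
  ν_integrable : ∫⁻ u, ENNReal.ofReal (min 1 (u ^ 2)) ∂ν < ∞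
  a_nonneg : 0 ≤ a
  c_nonneg : 0 ≤ c

/-- A Lévy triplet `(ν, d, c)`; `ν` is a measure on `(0,∞)`. -/
structure LevyTriplet where
  ν : Measure ℝ
  d : ℝ
  c : ℝ
  ν_carried : ν (Iic 0) = 0
  ν_integrable : ∫⁻ u, ENNReal.ofReal (min 1 u) ∂ν < ∞
  d_nonneg : 0 ≤ d
  c_nonneg : 0 ≤ c

/-- A Lévy pair `(ν, k)`; `ν` is a measure on `(0,∞)` with finite Laplace transform. -/
structure LevyPair where
  ν : Measure ℝ
  k : ℝ
  ν_carried : ν (Iic 0) = 0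
  ν_laplace : ∀ y : ℝ, 0 < y → ∫⁻ u, ENNReal.ofReal (Real.exp (-(u * y))) ∂ν < ∞
  k_nonneg : 0 ≤ k

/-- The Laplace symbol of an `x`-Lévy quadruplet. -/
def LevyQuadruplet.symbol {x : ℝ} (l : LevyQuadruplet x) (y : ℝ) : ℝ :=
  (∫ u, (Real.exp (-(u * y)) - 1 + u * y * (Icc (-1 : ℝ) 1).indicator 1 u) ∂l.ν)
    + l.a * y ^ 2 - l.b * y - l.c

/-- The Laplace symbol of a Lévy triplet. -/
def LevyTriplet.symbol (l : LevyTriplet) (y : ℝ) : ℝ :=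
  (∫ u, (Real.exp (-(u * y)) - 1) ∂l.ν) - l.d * y - l.c

/-- The Laplace symbol of a Lévy pair. -/
def LevyPair.symbol (l : LevyPair) (y : ℝ) : ℝ :=
  (∫ u, Real.exp (-(u * y)) ∂l.ν) + l.k

/-- A Lévy family `(l_x)_{x ∈ [0,∞]}`: a Lévy triplet at `0`, an `x`-Lévy quadruplet at each
`x ∈ (0,∞)`, depending measurably on `x`, and a Lévy pair at `∞`. -/
structure LevyFamily where
  atZero : LevyTriplet
  quad : ∀ x : Ioi (0 : ℝ), LevyQuadruplet x
  atInfty : LevyPair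
  measurable_ν : Measurable fun x => (quad x).ν
  measurable_a : Measurable fun x => (quad x).a
  measurable_b : Measurable fun x => (quad x).b
  measurable_c : Measurable fun x => (quad x).c

/-- The Laplace symbol `ψ_l(x, y)`, `x ∈ [0,∞]`, `y ∈ (0,∞)`, of a Lévy family. -/
def LevyFamily.symbol (l : LevyFamily) (x : ℝ≥0∞) (y : ℝ) : ℝ :=
  if h₀ : x = 0 then l.atZero.symbol y
  else if h₁ : x = ∞ then l.atInfty.symbol y
  else (l.quad ⟨x.toReal, ENNReal.toReal_pos h₀ h₁⟩).symbol y

/-- The restriction of `ψ` to `[0,∞] × (0,∞)` is the Laplace symbol of `l`. -/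
def LevyFamily.Represents (l : LevyFamily) (ψ : ℝ≥0∞ → ℝ≥0∞ → ℝ) : Prop :=
  ∀ (x : ℝ≥0∞) (y : ℝ), 0 < y → ψ x (ENNReal.ofReal y) = l.symbol x y

/-- The dual of a map on `[0,∞]²`: `(x, y) ↦ ψ (y, x)`. -/
def dual (ψ : ℝ≥0∞ → ℝ≥0∞ → ℝ) : ℝ≥0∞ → ℝ≥0∞ → ℝ := fun x y => ψ y x

/-- `ψ : [0,∞]² → ℝ` is a Laplace dual symbol when the restrictions to `[0,∞] × (0,∞)` of `ψ`
and of its dual are both Laplace symbols. -/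
def IsLaplaceDualSymbol (ψ : ℝ≥0∞ → ℝ≥0∞ → ℝ) : Prop :=
  (∃ l : LevyFamily, l.Represents ψ) ∧ ∃ l : LevyFamily, l.Represents (dual ψ)

/-- `ψ` vanishes at infinity: it is zero on `({∞} × [0,∞]) ∪ ([0,∞] × {∞})`. -/
def VanishesAtInfinity (ψ : ℝ≥0∞ → ℝ≥0∞ → ℝ) : Prop :=
  ∀ x, ψ ∞ x = 0 ∧ ψ x ∞ = 0

/-! ### Pregenerators -/

/-- A function on `[0,∞]` read along the real line (only arguments in `[0,∞)` matter). -/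
def onReal (f : ℝ≥0∞ → ℝ) (r : ℝ) : ℝ := f (ENNReal.ofReal r)

/-- Action of a Lévy triplet at the point `0`. -/
def LevyTriplet.act (l : LevyTriplet) (f : ℝ≥0∞ → ℝ) : ℝ :=
  (∫ u, (onReal f u - f 0) ∂l.ν) + l.d * derivWithin (onReal f) (Ici 0) 0 - l.c * f 0

/-- Action of an `x`-Lévy quadruplet at the point `x ∈ (0,∞)`. -/
def LevyQuadruplet.act {x : ℝ} (l : LevyQuadruplet x) (f : ℝ≥0∞ → ℝ) : ℝ :=
  (∫ u, (onReal f (x + u) - onReal f x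
      - u * deriv (onReal f) x * (Icc (-1 : ℝ) 1).indicator 1 u) ∂l.ν)
    + l.a * deriv (deriv (onReal f)) x + l.b * deriv (onReal f) x - l.c * onReal f x

/-- Action of a Lévy pair at the point `∞`. -/
def LevyPair.act (l : LevyPair) (f : ℝ≥0∞ → ℝ) : ℝ :=
  (∫ u, (onReal f u - f ∞) ∂l.ν) + l.k * (f 0 - f ∞)

/-- The Courrège form attached to a Lévy family. -/
def LevyFamily.act (l : LevyFamily) (f : ℝ≥0∞ → ℝ) (x : ℝ≥0∞) : ℝ :=
  if h₀ : x = 0 then l.atZero.act f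
  else if h₁ : x = ∞ then l.atInfty.act f
  else (l.quad ⟨x.toReal, ENNReal.toReal_pos h₀ h₁⟩).act f

/-- The (graph of the) pregenerator, with domain `𝒟`, associated to the restriction of `ψ` to
`[0,∞] × (0,∞)`. A Laplace symbol determines its Lévy family, so for a Laplace symbol this is
the graph of an operator on `𝒟`. -/
def pregenerator (ψ : ℝ≥0∞ → ℝ≥0∞ → ℝ) : Set ((ℝ≥0∞ → ℝ) × (ℝ≥0∞ → ℝ)) :=
  {p | p.1 ∈ expSpan ∧ ∃ l : LevyFamily, l.Represents ψ ∧ p.2 = l.act p.1}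

/-! ### Martingale problems -/

section Processes

variable {Ω : Type*} [MeasurableSpace Ω]

/-- `(f (X_t) - ∫₀ᵗ g (X_s) ds)_{t ≥ 0}` is a martingale in the natural filtration of `X`, the
Lebesgue integrals being well-defined and finite almost surely. -/
def IsIntegralMartingale (f g : ℝ≥0∞ → ℝ) (X : ℝ≥0 → Ω → ℝ≥0∞)
    (hX : ∀ t, StronglyMeasurable (X t)) (P : Measure Ω) : Prop :=
  (∀ t : ℝ≥0, ∀ᵐ ω ∂P,
      IntervalIntegrable (fun s : ℝ => g (X s.toNNReal ω)) volume 0 (t : ℝ)) ∧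
    Martingale (fun (t : ℝ≥0) ω => f (X t ω) - ∫ s in (0 : ℝ)..(t : ℝ), g (X s.toNNReal ω))
      (Filtration.natural X hX) P

/-- `(X, P)` is a solution to the martingale problem for `(A, μ)`. -/
structure IsMPSolution (A : Set ((ℝ≥0∞ → ℝ) × (ℝ≥0∞ → ℝ))) (μ : Measure ℝ≥0∞)
    (X : ℝ≥0 → Ω → ℝ≥0∞) (P : Measure Ω) : Prop where
  stronglyMeasurable : ∀ t, StronglyMeasurable (X t)
  progressive : IsStronglyProgressive (Filtration.natural X stronglyMeasurable) X
  initialLaw : P.map (X 0) = μ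
  martingale : ∀ p ∈ A, IsIntegralMartingale p.1 p.2 X stronglyMeasurable P

end Processes

/-! ### Path properties -/

/-- Càdlàg paths in `[0,∞]`. -/
def IsCadlag (f : ℝ≥0 → ℝ≥0∞) : Prop :=
  ∀ t, ContinuousWithinAt f (Ici t) t ∧ ∃ l, Tendsto f (𝓝[<] t) (𝓝 l)

/-- `inf {t : f_{t-} = b or f_t = b}`, with `f_{0-} = f_0` and `inf ∅ = ∞`. -/
def explosionTime (b : ℝ≥0∞) (f : ℝ≥0 → ℝ≥0∞) : ℝ≥0∞ :=
  ⨅ (t : ℝ≥0) (_ : Function.leftLim f t = b ∨ f t = b), (t : ℝ≥0∞)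

/-- The path is càdlàg and has the boundary point `b` strongly absorbing (it is minimal
at `b`). -/
def IsMinimalAt (b : ℝ≥0∞) (f : ℝ≥0 → ℝ≥0∞) : Prop :=
  IsCadlag f ∧ ∀ t : ℝ≥0, explosionTime b f ≤ t → f t = b

/-- The path does not explode continuously at `∞`. -/
def NoContinuousExplosion (f : ℝ≥0 → ℝ≥0∞) : Prop :=
  explosionTime ∞ f < ∞ → Function.leftLim f (explosionTime ∞ f).toNNReal ≠ ∞

/-- `inf {t : f_t > m}`. -/
def passageAbove (m : ℝ≥0∞) (f : ℝ≥0 → ℝ≥0∞) : ℝ≥0∞ :=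
  ⨅ (t : ℝ≥0) (_ : m < f t), (t : ℝ≥0∞)

/-- `inf {t : f_t < ε}`. -/
def passageBelow (ε : ℝ≥0∞) (f : ℝ≥0 → ℝ≥0∞) : ℝ≥0∞ :=
  ⨅ (t : ℝ≥0) (_ : f t < ε), (t : ℝ≥0∞)

/-- The boundary point `b` is non-sticky for a process `X` considered under a single probability
`P` under which it starts from `x₀`: if `x₀ ≠ b`, then `P (X_t ≠ b) = 1` for every `t`. -/
def NonSticky {Ω : Type*} [MeasurableSpace Ω] (b x₀ : ℝ≥0∞) (X : ℝ≥0 → Ω → ℝ≥0∞)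
    (P : Measure Ω) : Prop :=
  x₀ ≠ b → ∀ t, ∀ᵐ ω ∂P, X t ω ≠ b

/-! ### The conditions on `φ` -/

/-- `φ (x, y) = ψ (x, y) e^{-xy}`. -/
def phi (ψ : ℝ≥0∞ → ℝ≥0∞ → ℝ) (x y : ℝ≥0∞) : ℝ := ψ x y * expKernel x y

/-- `φ (x, ·)` is continuous at zero for all `x ∈ [0,∞)`. -/
def ContAtZero (φ : ℝ≥0∞ → ℝ≥0∞ → ℝ) : Prop :=
  ∀ x, x < ∞ → ContinuousAt (φ x) 0

/-- `lim_{y → ∞} φ (x, y) = 0` for `x ∈ (0,∞)`. -/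
def TendsToZeroAtInfinity (φ : ℝ≥0∞ → ℝ≥0∞ → ℝ) : Prop :=
  ∀ x, 0 < x → x < ∞ → Tendsto (fun y : ℝ≥0 => φ x y) atTop (𝓝 0)

/-- `φ` is bounded on `[0,m]²` for all `m ∈ [0,∞)`. -/
def BoundedOnSquares (φ : ℝ≥0∞ → ℝ≥0∞ → ℝ) : Prop :=
  ∀ m : ℝ≥0, ∃ C : ℝ, ∀ x y : ℝ≥0∞, x ≤ m → y ≤ m → |φ x y| ≤ C

/-- `φ` is bounded on `[0,m] × (ε,n)` for all `m, n, ε ∈ (0,∞)`. -/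
def BoundedOnStrips (φ : ℝ≥0∞ → ℝ≥0∞ → ℝ) : Prop :=
  ∀ m n ε : ℝ≥0, 0 < m → 0 < n → 0 < ε →
    ∃ C : ℝ, ∀ x y : ℝ≥0∞, x ≤ m → ε < y → y < n → |φ x y| ≤ C

/-- `φ (0, ·)` vanishes on `[0,∞]`. -/
def VanishesAtZero (φ : ℝ≥0∞ → ℝ≥0∞ → ℝ) : Prop := ∀ y, φ 0 y = 0

section Integrability

variable {Ω Ω' : Type*} [MeasurableSpace Ω] [MeasurableSpace Ω']

/-- `∫₀ᵀ ∫₀ᵀ 𝔼[(φ (X_{s ∧ σ}, Y_{t ∧ τ}))₊] 1_{[0,T]}(s + t) ds dt < ∞` for all `T`, where `𝔼`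
refers to the product measure `P × Q`. -/
def StoppedIntegrablePos (φ : ℝ≥0∞ → ℝ≥0∞ → ℝ)
    (X : ℝ≥0 → Ω → ℝ≥0∞) (σ : Ω → ℝ≥0∞) (P : Measure Ω)
    (Y : ℝ≥0 → Ω' → ℝ≥0∞) (τ : Ω' → ℝ≥0∞) (Q : Measure Ω') : Prop :=
  ∀ T : ℝ, 0 ≤ T →
    ∫⁻ t in Icc (0 : ℝ) T, ∫⁻ s in Icc (0 : ℝ) T,
      (Icc (0 : ℝ) T).indicator (fun _ => ∫⁻ ω, ENNReal.ofReal
          (φ (X (min (ENNReal.ofReal s) (σ ω.1)).toNNReal ω.1)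
            (Y (min (ENNReal.ofReal t) (τ ω.2)).toNNReal ω.2)) ∂(P.prod Q)) (s + t) < ∞

/-- The preceding with the positive part or with the negative part of `φ`, not necessarily
both. -/
def StoppedIntegrable (φ : ℝ≥0∞ → ℝ≥0∞ → ℝ)
    (X : ℝ≥0 → Ω → ℝ≥0∞) (σ : Ω → ℝ≥0∞) (P : Measure Ω)
    (Y : ℝ≥0 → Ω' → ℝ≥0∞) (τ : Ω' → ℝ≥0∞) (Q : Measure Ω') : Prop :=
  StoppedIntegrablePos φ X σ P Y τ Q ∨ StoppedIntegrablePos (fun x y => -φ x y) X σ P Y τ Q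

/-- `𝔼[|φ (X_σ, Y_τ)|; σ + τ ≤ t] < ∞` for almost every `t ∈ [0,∞)`. -/
def TerminalIntegrable (φ : ℝ≥0∞ → ℝ≥0∞ → ℝ)
    (X : ℝ≥0 → Ω → ℝ≥0∞) (σ : Ω → ℝ≥0∞) (P : Measure Ω)
    (Y : ℝ≥0 → Ω' → ℝ≥0∞) (τ : Ω' → ℝ≥0∞) (Q : Measure Ω') : Prop :=
  ∀ᵐ t ∂(volume.restrict (Ici (0 : ℝ))),
    ∫⁻ ω in {ω : Ω × Ω' | σ ω.1 + τ ω.2 ≤ ENNReal.ofReal t},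
      ENNReal.ofReal |φ (X (σ ω.1).toNNReal ω.1) (Y (τ ω.2).toNNReal ω.2)| ∂(P.prod Q) < ∞

end Integrability

end LaplaceDuality

end

open LaplaceDuality

noncomputable section

namespace LaplaceDuality

/-! ### The exponential kernel -/

lemma expKernel_comm (x y : ℝ≥0∞) : expKernel x y = expKernel y x := by
  simp only [expKernel, or_comm, mul_comm]

@[simp] lemma expKernel_top_left (y : ℝ≥0∞) : expKernel ∞ y = 0 := by simp [expKernel]

@[simp] lemma expKernel_top_right (x : ℝ≥0∞) : expKernel x ∞ = 0 := by simp [expKernel]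

lemma expKernel_zero_left {y : ℝ≥0∞} (hy : y ≠ ∞) : expKernel 0 y = 1 := by
  simp [expKernel, hy]

lemma expKernel_zero_right {x : ℝ≥0∞} (hx : x ≠ ∞) : expKernel x 0 = 1 := by
  simp [expKernel, hx]

lemma expKernel_of_ne_top {x y : ℝ≥0∞} (hx : x ≠ ∞) (hy : y ≠ ∞) :
    expKernel x y = Real.exp (-(x.toReal * y.toReal)) := by simp [expKernel, hx, hy]

lemma expKernel_nonneg (x y : ℝ≥0∞) : 0 ≤ expKernel x y := by
  unfold expKernel; split_ifs <;> positivity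

lemma expKernel_le_one (x y : ℝ≥0∞) : expKernel x y ≤ 1 := by
  unfold expKernel
  split_ifs
  · exact zero_le_one
  · exact Real.exp_le_one_iff.2 (neg_nonpos.2 (by positivity))

lemma abs_expKernel_le_one (x y : ℝ≥0∞) : |expKernel x y| ≤ 1 := by
  rw [abs_of_nonneg (expKernel_nonneg x y)]; exact expKernel_le_one x y

lemma measurable_expKernel : Measurable fun p : ℝ≥0∞ × ℝ≥0∞ => expKernel p.1 p.2 := by
  unfold expKernel
  refine Measurable.ite ?_ measurable_const (by fun_prop)
  exact (measurableSet_eq_fun measurable_fst measurable_const).union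
    (measurableSet_eq_fun measurable_snd measurable_const)

@[fun_prop]
lemma _root_.Measurable.expKernel {α : Type*} [MeasurableSpace α] {f g : α → ℝ≥0∞}
    (hf : Measurable f) (hg : Measurable g) :
    Measurable fun a => LaplaceDuality.expKernel (f a) (g a) :=
  measurable_expKernel.comp (hf.prodMk hg)

lemma continuousAt_expKernel_left {x y : ℝ≥0∞} (h : y ≠ 0 ∨ x ≠ ∞) :
    ContinuousAt (fun x => expKernel x y) x := by
  rcases eq_or_ne y ∞ with rfl | hy
  · simpa using continuousAt_const
  rcases eq_or_ne x ∞ with rfl | hx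
  · have hy0 : y ≠ 0 := by simpa using h
    have hlim : Tendsto (fun x : ℝ≥0∞ => (EReal.exp (-((x * y : ℝ≥0∞) : EReal))).toReal)
        (𝓝 ∞) (𝓝 0) := by
      have h1 : Tendsto (fun x : ℝ≥0∞ => x * y) (𝓝 ∞) (𝓝 (∞ * y)) :=
        (ENNReal.continuous_mul_const hy).tendsto ∞
      rw [ENNReal.top_mul hy0] at h1
      have h2 : Tendsto (fun z : ℝ≥0∞ => EReal.exp (-(z : EReal))) (𝓝 ∞)
          (𝓝 (EReal.exp (-((∞ : ℝ≥0∞) : EReal)))) :=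
        ((ENNReal.continuous_exp.comp continuous_neg).comp
          continuous_coe_ennreal_ereal).tendsto ∞
      have h3 := (ENNReal.tendsto_toReal (a := EReal.exp (-((∞ : ℝ≥0∞) : EReal)))
        (by simp)).comp (h2.comp h1)
      simpa [Function.comp_def] using h3
    refine ContinuousAt.congr (f := fun x : ℝ≥0∞ =>
      (EReal.exp (-((x * y : ℝ≥0∞) : EReal))).toReal) ?_ (.of_forall fun x => ?_)
    · simpa [ContinuousAt, ENNReal.top_mul hy0] using hlim
    · rcases eq_or_ne x ∞ with rfl | hx
      · simp [ENNReal.top_mul hy0]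
      · lift x to ℝ≥0 using hx
        lift y to ℝ≥0 using hy
        have e : (((x : ℝ≥0∞) * (y : ℝ≥0∞) : ℝ≥0∞) : EReal) = ((x * y : ℝ) : EReal) := by
          rw [← ENNReal.coe_mul]; rfl
        simp only [e, ← EReal.coe_neg, EReal.exp_coe]
        rw [ENNReal.toReal_ofReal (Real.exp_pos _).le,
          expKernel_of_ne_top ENNReal.coe_ne_top ENNReal.coe_ne_top]
        simp
  · have : ContinuousAt (fun x : ℝ≥0∞ => Real.exp (-(x.toReal * y.toReal))) x := by
      have := ENNReal.tendsto_toReal hx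
      exact Real.continuous_exp.continuousAt.comp (this.mul_const _).neg
    refine this.congr ?_
    filter_upwards [isOpen_ne.mem_nhds hx] with z hz
    rw [expKernel_of_ne_top hz hy]

lemma continuousAt_expKernel_right {x y : ℝ≥0∞} (h : x ≠ 0 ∨ y ≠ ∞) :
    ContinuousAt (fun y => expKernel x y) y := by
  simpa only [expKernel_comm x] using continuousAt_expKernel_left h

lemma onReal_expKernel {y : ℝ≥0∞} (hy : y ≠ ∞) {r : ℝ} (hr : 0 ≤ r) :
    onReal (fun x => expKernel x y) r = Real.exp (-(r * y.toReal)) := by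
  rw [onReal, expKernel_of_ne_top ENNReal.ofReal_ne_top hy, ENNReal.toReal_ofReal hr]

/-! ### Laplace symbols -/

lemma abs_exp_sub_one_sub_le (z : ℝ) : |Real.exp z - 1 - z| ≤ z ^ 2 * Real.exp |z| := by
  have h := Complex.norm_exp_sub_sum_le_norm_mul_exp (z : ℂ) 2
  simp only [Finset.sum_range_succ, Finset.sum_range_zero, pow_zero, pow_one, Nat.factorial,
    Complex.norm_real, Real.norm_eq_abs, sq_abs] at h
  have e : Complex.exp z - (0 + 1 / ((1 : ℕ) : ℂ) + (z : ℂ) / (((0 + 1) * 1 : ℕ) : ℂ))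
      = ((Real.exp z - 1 - z : ℝ) : ℂ) := by
    push_cast; ring
  rw [e, Complex.norm_real, Real.norm_eq_abs] at h
  exact h

/-- The compensated integrand of a Lévy quadruplet. -/
def compExp (y u : ℝ) : ℝ :=
  Real.exp (-(u * y)) - 1 + u * y * (Icc (-1 : ℝ) 1).indicator 1 u

lemma measurable_compExp (y : ℝ) : Measurable (compExp y) := by
  unfold compExp
  have : Measurable ((Icc (-1 : ℝ) 1).indicator (1 : ℝ → ℝ)) :=
    measurable_one.indicator measurableSet_Icc
  fun_prop

lemma mul_exp_neg_mul_le {x y : ℝ} (hx : 0 < x) : y * Real.exp (-(x * y)) ≤ 1 / x := by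
  have h1 := Real.add_one_le_exp (x * y)
  rw [Real.exp_neg, le_div_iff₀ hx]
  have h2 : x * y ≤ Real.exp (x * y) := by linarith
  have h3 := mul_le_mul_of_nonneg_right h2 (inv_nonneg.2 (Real.exp_pos (x * y)).le)
  rw [mul_inv_cancel₀ (Real.exp_pos _).ne'] at h3
  linarith

lemma sq_mul_exp_neg_le {x y : ℝ} (hx : 0 < x) (hy : 0 ≤ y) :
    y ^ 2 * Real.exp (-(x * y)) ≤ 4 / x ^ 2 := by
  have h := mul_exp_neg_mul_le (x := x / 2) (y := y) (by positivity)
  have h0 : 0 ≤ y * Real.exp (-(x / 2 * y)) := by positivity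
  have e : y ^ 2 * Real.exp (-(x * y)) = (y * Real.exp (-(x / 2 * y))) ^ 2 := by
    rw [mul_pow, ← Real.exp_nat_mul]; congr 2; push_cast; ring
  rw [e]
  calc _ ≤ (1 / (x / 2)) ^ 2 := pow_le_pow_left₀ h0 h 2
    _ = 4 / x ^ 2 := by field_simp; norm_num

lemma exists_abs_compExp_mul_le {x : ℝ} (hx : 0 < x) :
    ∃ C, 0 ≤ C ∧ ∀ y u, 0 < y → -x ≤ u →
      |compExp y u * Real.exp (-(x * y))| ≤ C * min 1 (u ^ 2) := by
  set κ := min 1 (x / 2) with hκ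
  have hκ0 : 0 < κ := lt_min one_pos (by positivity)
  have hκ1 : κ ≤ 1 := min_le_left _ _
  have hκ2 : κ ≤ x / 2 := min_le_right _ _
  refine ⟨4 / (x / 2) ^ 2 + (2 + 1 / x) / κ ^ 2, by positivity, fun y u hy hu => ?_⟩
  rw [abs_mul, abs_of_pos (Real.exp_pos _)]
  rcases le_or_gt |u| κ with hu' | hu'
  · have hu1 : u ∈ Icc (-1 : ℝ) 1 := abs_le.1 (hu'.trans hκ1)
    have hsq : u ^ 2 ≤ 1 := by nlinarith [hu1.1, hu1.2]
    have h1 : |compExp y u| ≤ (u * y) ^ 2 * Real.exp (|u| * y) := by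
      have := abs_exp_sub_one_sub_le (-(u * y))
      rw [abs_neg, abs_mul, abs_of_pos hy, neg_sq] at this
      rw [compExp, indicator_of_mem hu1]
      convert this using 2
      simp
    rw [min_eq_right hsq]
    calc |compExp y u| * Real.exp (-(x * y))
        ≤ (u * y) ^ 2 * Real.exp (|u| * y) * Real.exp (-(x * y)) := by gcongr
      _ = u ^ 2 * (y ^ 2 * Real.exp (|u| * y - x * y)) := by
          rw [sub_eq_add_neg, Real.exp_add]; ring
      _ ≤ u ^ 2 * (y ^ 2 * Real.exp (-(x / 2 * y))) := by
          gcongr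
          nlinarith
      _ ≤ u ^ 2 * (4 / (x / 2) ^ 2) := by
          gcongr
          exact sq_mul_exp_neg_le (by positivity) hy.le
      _ ≤ (4 / (x / 2) ^ 2 + (2 + 1 / x) / κ ^ 2) * u ^ 2 := by
          rw [mul_comm]
          gcongr
          exact le_add_of_nonneg_right (by positivity)
  · have hmin : κ ^ 2 ≤ min 1 (u ^ 2) :=
      le_min (pow_le_one₀ hκ0.le hκ1) (sq_le_sq.2 (by rw [abs_of_pos hκ0]; exact hu'.le))
    have h1 : |compExp y u| ≤ Real.exp (-(u * y)) + 1 + y := by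
      unfold compExp
      refine (abs_add_le _ _).trans (add_le_add ?_ ?_)
      · refine (abs_sub _ _).trans ?_
        simp [abs_of_pos (Real.exp_pos _)]
      · by_cases hu1 : u ∈ Icc (-1 : ℝ) 1
        · rw [indicator_of_mem hu1, Pi.one_apply, mul_one, abs_mul, abs_of_pos hy]
          exact mul_le_of_le_one_left hy.le (abs_le.2 hu1)
        · rw [indicator_of_notMem hu1]; simpa using hy.le
    calc |compExp y u| * Real.exp (-(x * y))
        ≤ (Real.exp (-(u * y)) + 1 + y) * Real.exp (-(x * y)) := by gcongr
      _ = Real.exp (-((u + x) * y)) + Real.exp (-(x * y)) + y * Real.exp (-(x * y)) := by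
          rw [show -((u + x) * y) = -(u * y) + -(x * y) by ring, Real.exp_add]; ring
      _ ≤ 1 + 1 + 1 / x := by
          gcongr
          · exact Real.exp_le_one_iff.2 (by nlinarith)
          · exact Real.exp_le_one_iff.2 (by nlinarith)
          · exact mul_exp_neg_mul_le hx
      _ = (2 + 1 / x) / κ ^ 2 * κ ^ 2 := by field_simp; ring
      _ ≤ (4 / (x / 2) ^ 2 + (2 + 1 / x) / κ ^ 2) * min 1 (u ^ 2) := by
          gcongr
          exact le_add_of_nonneg_left (by positivity)

lemma LevyQuadruplet.integrable_min {x : ℝ} (l : LevyQuadruplet x) :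
    Integrable (fun u => min 1 (u ^ 2)) l.ν :=
  ⟨by fun_prop, (hasFiniteIntegral_iff_ofReal (.of_forall fun u => by positivity)).2
    l.ν_integrable⟩

lemma LevyQuadruplet.ae_ge {x : ℝ} (l : LevyQuadruplet x) : ∀ᵐ u ∂l.ν, -x ≤ u := by
  rw [ae_iff]; simpa [Iio] using l.ν_carried

/-- `e^{-xy}` times the symbol of an `x`-Lévy quadruplet. -/
def LevyQuadruplet.damped {x : ℝ} (l : LevyQuadruplet x) (y : ℝ) : ℝ :=
  l.symbol y * Real.exp (-(x * y))

lemma LevyQuadruplet.damped_eq {x : ℝ} (l : LevyQuadruplet x) (y : ℝ) :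
    l.damped y = (∫ u, compExp y u * Real.exp (-(x * y)) ∂l.ν)
      + (l.a * y ^ 2 - l.b * y - l.c) * Real.exp (-(x * y)) := by
  rw [integral_mul_const, damped, symbol]
  simp only [compExp]
  ring

lemma LevyQuadruplet.continuousOn_damped {x : ℝ} (hx : 0 < x) (l : LevyQuadruplet x) :
    ContinuousOn l.damped (Ioi 0) := by
  obtain ⟨C, -, hC⟩ := exists_abs_compExp_mul_le hx
  simp only [funext l.damped_eq]
  refine ContinuousOn.add (continuousOn_of_dominated (bound := fun u => C * min 1 (u ^ 2))
    (fun y _ => ((measurable_compExp y).mul_const _).aestronglyMeasurable)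
    (fun y hy => ?_) (l.integrable_min.const_mul C) (.of_forall fun u => ?_)) (by fun_prop)
  · filter_upwards [l.ae_ge] with u hu using hC y u hy hu
  · unfold compExp; fun_prop

lemma LevyQuadruplet.continuousOn_symbol {x : ℝ} (hx : 0 < x) (l : LevyQuadruplet x) :
    ContinuousOn l.symbol (Ioi 0) := by
  have h : l.symbol = fun y => l.damped y * Real.exp (x * y) := by
    ext y; rw [damped, mul_assoc, ← Real.exp_add]; simp
  rw [h]
  exact (l.continuousOn_damped hx).mul (by fun_prop)

lemma LevyQuadruplet.exists_abs_damped_le {x : ℝ} (hx : 0 < x) (l : LevyQuadruplet x) :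
    ∃ C, ∀ y, 0 < y → |l.damped y| ≤ C := by
  obtain ⟨C, hC0, hC⟩ := exists_abs_compExp_mul_le hx
  refine ⟨C * (∫ u, min 1 (u ^ 2) ∂l.ν) + (l.a * (4 / x ^ 2) + |l.b| * (1 / x) + l.c),
    fun y hy => ?_⟩
  rw [l.damped_eq, ← integral_const_mul]
  refine (abs_add_le _ _).trans (add_le_add ?_ ?_)
  · rw [← Real.norm_eq_abs]
    refine norm_integral_le_of_norm_le (l.integrable_min.const_mul C) ?_
    filter_upwards [l.ae_ge] with u hu using hC y u hy hu
  · have h2 := sq_mul_exp_neg_le hx hy.le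
    have h1 := mul_exp_neg_mul_le (y := y) hx
    have h0 : Real.exp (-(x * y)) ≤ 1 := Real.exp_le_one_iff.2 (by nlinarith)
    have e : (l.a * y ^ 2 - l.b * y - l.c) * Real.exp (-(x * y)) =
      l.a * (y ^ 2 * Real.exp (-(x * y))) - l.b * (y * Real.exp (-(x * y)))
        - l.c * Real.exp (-(x * y)) := by ring
    rw [e]
    refine (abs_sub _ _).trans (add_le_add ((abs_sub _ _).trans (add_le_add ?_ ?_)) ?_)
    · rw [abs_of_nonneg (by have := l.a_nonneg; positivity)]
      exact mul_le_mul_of_nonneg_left h2 l.a_nonneg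
    · rw [abs_mul, abs_of_nonneg (a := y * _) (by positivity)]
      exact mul_le_mul_of_nonneg_left h1 (abs_nonneg _)
    · rw [abs_of_nonneg (by have := l.c_nonneg; positivity)]
      exact mul_le_of_le_one_right l.c_nonneg h0

lemma LevyTriplet.ae_pos (l : LevyTriplet) : ∀ᵐ u ∂l.ν, 0 < u := by
  rw [ae_iff]; simpa [Iic] using l.ν_carried

lemma LevyTriplet.integrable_min (l : LevyTriplet) : Integrable (fun u => min 1 u) l.ν := by
  refine ⟨by fun_prop, (hasFiniteIntegral_iff_ofReal ?_).2 l.ν_integrable⟩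
  filter_upwards [l.ae_pos] with u hu using le_min zero_le_one hu.le

lemma LevyTriplet.continuousOn_symbol (l : LevyTriplet) : ContinuousOn l.symbol (Ioi 0) := by
  suffices h : ∀ β : ℝ, ContinuousOn l.symbol (Ioo 0 β) by
    intro y hy
    exact ((h (y + 1)).continuousAt (Ioo_mem_nhds hy (lt_add_one y))).continuousWithinAt
  intro β
  unfold symbol
  refine ContinuousOn.sub (ContinuousOn.sub ?_ (by fun_prop)) (by fun_prop)
  refine continuousOn_of_dominated (bound := fun u => (1 + β) * min 1 u)
    (fun y _ => by fun_prop) (fun y hy => ?_) (l.integrable_min.const_mul _)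
    (.of_forall fun u => by fun_prop)
  filter_upwards [l.ae_pos] with u hu
  have h1 : Real.exp (-(u * y)) ≤ 1 := Real.exp_le_one_iff.2 (by nlinarith [hy.1])
  have h2 := Real.add_one_le_exp (-(u * y))
  have h3 := Real.exp_pos (-(u * y))
  rw [Real.norm_eq_abs, abs_of_nonpos (by linarith)]
  rcases le_total 1 u with h | h
  · rw [min_eq_left h]; linarith [hy.1, hy.2]
  · rw [min_eq_right h]; nlinarith [hy.1, hy.2]

lemma LevyTriplet.symbol_nonpos (l : LevyTriplet) {y : ℝ} (hy : 0 < y) : l.symbol y ≤ 0 := by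
  have h : ∫ u, (Real.exp (-(u * y)) - 1) ∂l.ν ≤ 0 := by
    refine integral_nonpos_of_ae ?_
    filter_upwards [l.ae_pos] with u hu
    simpa using mul_nonneg hu.le hy.le
  have := mul_nonneg l.d_nonneg hy.le
  have := l.c_nonneg
  unfold symbol
  linarith

/-! ### Laplace dual symbols -/

lemma phi_dual (ψ : ℝ≥0∞ → ℝ≥0∞ → ℝ) (x y : ℝ≥0∞) : phi (dual ψ) y x = phi ψ x y := by
  simp only [phi, dual, expKernel_comm]

lemma IsLaplaceDualSymbol.dual {ψ : ℝ≥0∞ → ℝ≥0∞ → ℝ} (h : IsLaplaceDualSymbol ψ) :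
    IsLaplaceDualSymbol (dual ψ) := ⟨h.2, h.1⟩

lemma VanishesAtInfinity.dual {ψ : ℝ≥0∞ → ℝ≥0∞ → ℝ} (h : VanishesAtInfinity ψ) :
    VanishesAtInfinity (dual ψ) := fun x => ⟨(h x).2, (h x).1⟩

@[simp] lemma phi_top_left (ψ : ℝ≥0∞ → ℝ≥0∞ → ℝ) (y : ℝ≥0∞) : phi ψ ∞ y = 0 := by simp [phi]

@[simp] lemma phi_top_right (ψ : ℝ≥0∞ → ℝ≥0∞ → ℝ) (x : ℝ≥0∞) : phi ψ x ∞ = 0 := by simp [phi]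

lemma LevyFamily.symbol_zero (l : LevyFamily) (y : ℝ) : l.symbol 0 y = l.atZero.symbol y := by
  simp [symbol]

lemma LevyFamily.symbol_top (l : LevyFamily) (y : ℝ) : l.symbol ∞ y = l.atInfty.symbol y := by
  simp [symbol]

lemma LevyFamily.symbol_of_pos (l : LevyFamily) {x : ℝ≥0∞} (h₀ : x ≠ 0) (h₁ : x ≠ ∞) (y : ℝ) :
    l.symbol x y = (l.quad ⟨x.toReal, ENNReal.toReal_pos h₀ h₁⟩).symbol y := by
  simp [symbol, h₀, h₁]

lemma LevyFamily.Represents.apply {l : LevyFamily} {ψ : ℝ≥0∞ → ℝ≥0∞ → ℝ}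
    (h : l.Represents ψ) (x : ℝ≥0∞) {y : ℝ≥0∞} (h₀ : y ≠ 0) (h₁ : y ≠ ∞) :
    ψ x y = l.symbol x y.toReal := by
  rw [← h x _ (ENNReal.toReal_pos h₀ h₁), ENNReal.ofReal_toReal h₁]

lemma IsLaplaceDualSymbol.exists_abs_phi_le_left {ψ : ℝ≥0∞ → ℝ≥0∞ → ℝ}
    (h : IsLaplaceDualSymbol ψ) {x : ℝ≥0∞} (hx : x ≠ 0) : ∃ C, ∀ y, |phi ψ x y| ≤ C := by
  rcases eq_or_ne x ∞ with rfl | hx'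
  · exact ⟨0, by simp⟩
  obtain ⟨l, hl⟩ := h.1
  set q := l.quad ⟨x.toReal, ENNReal.toReal_pos hx hx'⟩
  obtain ⟨C, hC⟩ := q.exists_abs_damped_le (ENNReal.toReal_pos hx hx')
  refine ⟨max C |phi ψ x 0|, fun y => ?_⟩
  rcases eq_or_ne y 0 with rfl | hy
  · exact le_max_right _ _
  rcases eq_or_ne y ∞ with rfl | hy'
  · simp
  refine le_trans (le_of_eq ?_) ((hC _ (ENNReal.toReal_pos hy hy')).trans (le_max_left _ _))
  rw [phi, hl.apply x hy hy', l.symbol_of_pos hx hx', expKernel_of_ne_top hx' hy',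
    LevyQuadruplet.damped]

lemma IsLaplaceDualSymbol.phi_zero_nonpos {ψ : ℝ≥0∞ → ℝ≥0∞ → ℝ}
    (h : IsLaplaceDualSymbol ψ) {y : ℝ≥0∞} (hy : y ≠ 0) : phi ψ 0 y ≤ 0 := by
  rcases eq_or_ne y ∞ with rfl | hy'
  · simp
  obtain ⟨l, hl⟩ := h.1
  rw [phi, hl.apply 0 hy hy', l.symbol_zero]
  exact mul_nonpos_of_nonpos_of_nonneg (l.atZero.symbol_nonpos (ENNReal.toReal_pos hy hy'))
    (expKernel_nonneg _ _)

lemma continuous_comp_exp {f : ℝ → ℝ} (hf : ContinuousOn f (Ioi 0)) :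
    Continuous fun t => f (Real.exp t) :=
  hf.comp_continuous Real.continuous_exp Real.exp_pos

lemma LevyFamily.Represents.continuous_exp {l : LevyFamily} {ψ : ℝ≥0∞ → ℝ≥0∞ → ℝ}
    (h : l.Represents ψ) {x : ℝ≥0∞} (hx : x ≠ ∞) :
    Continuous fun t => ψ x (ENNReal.ofReal (Real.exp t)) := by
  simp only [fun t => h x _ (Real.exp_pos t)]
  rcases eq_or_ne x 0 with rfl | hx0
  · simp only [l.symbol_zero]
    exact continuous_comp_exp l.atZero.continuousOn_symbol
  · simp only [l.symbol_of_pos hx0 hx]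
    exact continuous_comp_exp
      ((l.quad ⟨_, _⟩).continuousOn_symbol (ENNReal.toReal_pos hx0 hx))

lemma ofReal_exp_log_toReal {x : ℝ≥0∞} (h₀ : x ≠ 0) (h₁ : x ≠ ∞) :
    ENNReal.ofReal (Real.exp (Real.log x.toReal)) = x := by
  rw [Real.exp_log (ENNReal.toReal_pos h₀ h₁), ENNReal.ofReal_toReal h₁]

lemma IsLaplaceDualSymbol.measurable_phi {ψ : ℝ≥0∞ → ℝ≥0∞ → ℝ} (h : IsLaplaceDualSymbol ψ) :
    Measurable fun p : ℝ≥0∞ × ℝ≥0∞ => phi ψ p.1 p.2 := by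
  classical
  obtain ⟨⟨l, hl⟩, ⟨l', hl'⟩⟩ := h
  have hG : Measurable (Function.uncurry fun t s : ℝ =>
      ψ (ENNReal.ofReal (Real.exp t)) (ENNReal.ofReal (Real.exp s))) :=
    measurable_uncurry_of_continuous_of_measurable
      (fun s => hl'.continuous_exp ENNReal.ofReal_ne_top)
      (fun t => (hl.continuous_exp ENNReal.ofReal_ne_top).measurable)
  have h0 := (hl.continuous_exp ENNReal.zero_ne_top).measurable
  have h0' := (hl'.continuous_exp ENNReal.zero_ne_top).measurable
  have e : (fun p : ℝ≥0∞ × ℝ≥0∞ => phi ψ p.1 p.2) = fun p =>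
      (if p.1 = ∞ then 0 else if p.2 = ∞ then 0 else
        if p.1 = 0 then (if p.2 = 0 then ψ 0 0 else
          ψ 0 (ENNReal.ofReal (Real.exp (Real.log p.2.toReal))))
        else if p.2 = 0 then ψ (ENNReal.ofReal (Real.exp (Real.log p.1.toReal))) 0
        else Function.uncurry (fun t s : ℝ =>
          ψ (ENNReal.ofReal (Real.exp t)) (ENNReal.ofReal (Real.exp s)))
          (Real.log p.1.toReal, Real.log p.2.toReal)) * expKernel p.1 p.2 := by
    ext ⟨x, y⟩
    by_cases hx : x = ∞
    · simp [hx]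
    by_cases hy : y = ∞
    · simp [hy]
    by_cases hx0 : x = 0 <;> by_cases hy0 : y = 0 <;>
      simp [phi, hx, hy, hx0, hy0, ofReal_exp_log_toReal]
  rw [e]
  have m1 : ∀ c : ℝ≥0∞, MeasurableSet {p : ℝ≥0∞ × ℝ≥0∞ | p.1 = c} := fun c =>
    measurableSet_eq_fun measurable_fst measurable_const
  have m2 : ∀ c : ℝ≥0∞, MeasurableSet {p : ℝ≥0∞ × ℝ≥0∞ | p.2 = c} := fun c =>
    measurableSet_eq_fun measurable_snd measurable_const
  have l1 : Measurable fun p : ℝ≥0∞ × ℝ≥0∞ => Real.log p.1.toReal := by fun_prop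
  have l2 : Measurable fun p : ℝ≥0∞ × ℝ≥0∞ => Real.log p.2.toReal := by fun_prop
  refine Measurable.mul ?_ measurable_expKernel
  exact .ite (m1 _) measurable_const <| .ite (m2 _) measurable_const <|
    .ite (m1 _) (.ite (m2 _) measurable_const (h0.comp l2)) <|
    .ite (m2 _) (h0'.comp l1) (hG.comp (l1.prodMk l2))

/-! ### The pregenerator on exponentials -/

lemma LevyTriplet.act_expKernel (l : LevyTriplet) {y : ℝ≥0∞} (hy : y ≠ ∞) :
    l.act (fun x => expKernel x y) = l.symbol y.toReal := by
  have hd : derivWithin (onReal fun x => expKernel x y) (Ici 0) 0 = -y.toReal := by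
    have h : HasDerivWithinAt (fun r : ℝ => Real.exp (-(r * y.toReal))) (-y.toReal) (Ici 0) 0 := by
      have := (((hasDerivAt_id (0 : ℝ)).mul_const y.toReal).neg.exp).hasDerivWithinAt (s := Ici 0)
      simpa using this
    exact (h.congr (fun r hr => onReal_expKernel hy hr) (onReal_expKernel hy le_rfl)).derivWithin
      (uniqueDiffOn_Ici 0 0 self_mem_Ici)
  have hi : ∫ u, (onReal (fun x => expKernel x y) u - expKernel 0 y) ∂l.ν
      = ∫ u, (Real.exp (-(u * y.toReal)) - 1) ∂l.ν := by
    refine integral_congr_ae ?_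
    filter_upwards [l.ae_pos] with u hu
    rw [onReal_expKernel hy hu.le, expKernel_zero_left hy]
  rw [act, symbol, hd, hi, expKernel_zero_left hy]
  ring

lemma LevyPair.act_expKernel (l : LevyPair) {y : ℝ≥0∞} (hy : y ≠ ∞) :
    l.act (fun x => expKernel x y) = l.symbol y.toReal := by
  have hp : ∀ᵐ u ∂l.ν, 0 < u := by
    rw [ae_iff]; simpa [Iic] using l.ν_carried
  have hi : ∫ u, (onReal (fun x => expKernel x y) u - expKernel ∞ y) ∂l.ν
      = ∫ u, Real.exp (-(u * y.toReal)) ∂l.ν := by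
    refine integral_congr_ae ?_
    filter_upwards [hp] with u hu
    rw [onReal_expKernel hy hu.le, expKernel_top_left, sub_zero]
  rw [act, symbol, hi, expKernel_zero_left hy, expKernel_top_left]
  ring

lemma LevyQuadruplet.act_expKernel {x : ℝ} (hx : 0 < x) (l : LevyQuadruplet x) {y : ℝ≥0∞}
    (hy : y ≠ ∞) :
    l.act (fun x => expKernel x y) = l.symbol y.toReal * Real.exp (-(x * y.toReal)) := by
  set f := onReal fun x => expKernel x y with hf
  set c := y.toReal with hc
  have hfe : ∀ r, 0 < r → f =ᶠ[𝓝 r] fun r => Real.exp (-(r * c)) := fun r hr => by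
    filter_upwards [Ioi_mem_nhds hr] with s hs using onReal_expKernel hy (le_of_lt hs)
  have hE : ∀ r : ℝ, HasDerivAt (fun r => Real.exp (-(r * c))) (-c * Real.exp (-(r * c))) r := by
    intro r
    have := ((hasDerivAt_id r).mul_const c).neg.exp
    simpa [mul_comm] using this
  have hd : ∀ r, 0 < r → deriv f r = -c * Real.exp (-(r * c)) := fun r hr => by
    rw [(hfe r hr).deriv_eq, (hE r).deriv]
  have hdd : deriv (deriv f) x = c ^ 2 * Real.exp (-(x * c)) := by
    have : deriv f =ᶠ[𝓝 x] fun r => -c * Real.exp (-(r * c)) := by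
      filter_upwards [Ioi_mem_nhds hx] with s hs using hd s hs
    rw [this.deriv_eq, ((hE x).const_mul (-c)).deriv]
    ring
  have hi : ∫ u, (f (x + u) - f x - u * deriv f x * (Icc (-1 : ℝ) 1).indicator 1 u) ∂l.ν
      = (∫ u, compExp c u ∂l.ν) * Real.exp (-(x * c)) := by
    rw [← integral_mul_const]
    refine integral_congr_ae ?_
    filter_upwards [l.ae_ge] with u hu
    rw [hd x hx, hf, onReal_expKernel hy hx.le, onReal_expKernel hy (by linarith), compExp,
      show -((x + u) * y.toReal) = -(u * c) + -(x * c) by rw [hc]; ring, Real.exp_add]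
    ring
  rw [act, hi, hdd, hd x hx, onReal_expKernel hy hx.le, symbol]
  simp only [compExp]
  ring

lemma mem_pregenerator {ψ : ℝ≥0∞ → ℝ≥0∞ → ℝ} (h : IsLaplaceDualSymbol ψ)
    (hv : VanishesAtInfinity ψ) {y : ℝ≥0∞} (hy : y ≠ 0) (hy' : y ≠ ∞) :
    ((fun x => expKernel x y), fun x => phi ψ x y) ∈ pregenerator ψ := by
  obtain ⟨l, hl⟩ := h.1
  refine ⟨Submodule.subset_span ⟨y, pos_iff_ne_zero.2 hy, hy'.lt_top, rfl⟩, l, hl, ?_⟩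
  ext x
  simp only [LevyFamily.act]
  split_ifs with h₀ h₁
  · rw [l.atZero.act_expKernel hy', ← l.symbol_zero, ← hl.apply 0 hy hy', phi, h₀,
      expKernel_zero_left hy', mul_one]
  · rw [l.atInfty.act_expKernel hy', ← l.symbol_top, ← hl.apply ∞ hy hy', (hv y).1, h₁,
      phi_top_left]
  · rw [LevyQuadruplet.act_expKernel (ENNReal.toReal_pos h₀ h₁) _ hy', ← l.symbol_of_pos h₀ h₁,
      ← hl.apply x hy hy', phi, expKernel_of_ne_top h₁ hy']

/-! ### Optional times -/

section Optional

variable {Ω : Type*} {m : MeasurableSpace Ω} {P : Measure Ω}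

/-- `σ` is an optional time: `{σ < t}` belongs to the `σ`-field at time `t`. -/
def IsOptionalTime (F : Filtration ℝ≥0 m) (σ : Ω → ℝ≥0∞) : Prop :=
  ∀ t : ℝ≥0, MeasurableSet[F t] {ω | σ ω < t}

lemma isOptionalTime_top (F : Filtration ℝ≥0 m) : IsOptionalTime F fun _ => ∞ := fun t => by
  simp

lemma IsOptionalTime.min {F : Filtration ℝ≥0 m} {σ τ : Ω → ℝ≥0∞} (hσ : IsOptionalTime F σ)
    (hτ : IsOptionalTime F τ) : IsOptionalTime F fun ω => min (σ ω) (τ ω) := fun t => by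
  simp only [min_lt_iff]
  exact (hσ t).union (hτ t)

lemma IsOptionalTime.measurable {F : Filtration ℝ≥0 m} {σ : Ω → ℝ≥0∞}
    (hσ : IsOptionalTime F σ) : Measurable σ := by
  refine measurable_of_Iio fun a => ?_
  have : σ ⁻¹' Iio a = ⋃ q : {q : ℚ // 0 ≤ q ∧ ENNReal.ofReal q ≤ a},
      {ω | σ ω < ((q.1 : ℝ).toNNReal : ℝ≥0)} := by
    ext ω
    simp only [mem_preimage, mem_Iio, mem_iUnion]
    constructor
    · intro h
      obtain ⟨q, hq0, h1, h2⟩ := ENNReal.lt_iff_exists_rat_btwn.1 h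
      exact ⟨⟨q, hq0, h2.le⟩, h1⟩
    · rintro ⟨q, hq⟩
      exact lt_of_lt_of_le hq q.2.2
  rw [this]
  exact MeasurableSet.iUnion fun q => F.le _ _ (hσ _)

/-- The approximation of `v ∧ t` from the right on the grid of mesh `(n + 1)⁻¹`, cut off at `t`. -/
def gridAbove (t : ℝ≥0) (n : ℕ) (v : ℝ≥0) : ℝ≥0 :=
  min t ((⌊(n + 1 : ℝ≥0) * v⌋₊ + 1) / (n + 1))

lemma gridAbove_le (t : ℝ≥0) (n : ℕ) (v : ℝ≥0) : gridAbove t n v ≤ t := min_le_left _ _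

lemma le_gridAbove {t v : ℝ≥0} (hv : v ≤ t) (n : ℕ) : v ≤ gridAbove t n v := by
  refine le_min hv ?_
  rw [le_div_iff₀ (by positivity), mul_comm]
  exact (Nat.lt_floor_add_one _).le

lemma gridAbove_le_add (t : ℝ≥0) (n : ℕ) (v : ℝ≥0) : gridAbove t n v ≤ v + 1 / (n + 1) := by
  refine (min_le_right _ _).trans ?_
  rw [add_div]
  gcongr
  rw [div_le_iff₀ (by positivity), mul_comm]
  exact Nat.floor_le (by positivity)

lemma tendsto_gridAbove {t v : ℝ≥0} (hv : v ≤ t) :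
    Tendsto (fun n => gridAbove t n v) atTop (𝓝[≥] v) := by
  refine tendsto_nhdsWithin_iff.2 ⟨?_, .of_forall fun n => le_gridAbove hv n⟩
  refine tendsto_of_tendsto_of_tendsto_of_le_of_le tendsto_const_nhds ?_
    (fun n => le_gridAbove hv n) (fun n => gridAbove_le_add t n v)
  simpa using tendsto_const_nhds.add (tendsto_one_div_add_atTop_nhds_zero_nat (𝕜 := ℝ≥0))

lemma isStoppingTime_gridAbove {F : Filtration ℝ≥0 m} {σ : Ω → ℝ≥0∞} (hσ : IsOptionalTime F σ)
    (t : ℝ≥0) (n : ℕ) :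
    IsStoppingTime F fun ω => ((gridAbove t n (min (t : ℝ≥0∞) (σ ω)).toNNReal : ℝ≥0) :
      WithTop ℝ≥0) := by
  intro s
  simp only [WithTop.coe_le_coe]
  rcases le_or_gt t s with h | h
  · simp [(gridAbove_le _ _ _).trans h]
  · set r : ℝ≥0 := ⌊(n + 1 : ℝ≥0) * s⌋₊ / (n + 1) with hr
    have hrs : r ≤ s := by
      rw [hr, div_le_iff₀ (by positivity), mul_comm]
      exact Nat.floor_le (by positivity)
    have : {ω | gridAbove t n (min (t : ℝ≥0∞) (σ ω)).toNNReal ≤ s} = {ω | σ ω < r} := by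
      ext ω
      simp only [mem_ofPred_eq]
      have hne : min (t : ℝ≥0∞) (σ ω) ≠ ∞ := ne_top_of_le_ne_top ENNReal.coe_ne_top (min_le_left _ _)
      set v := (min (t : ℝ≥0∞) (σ ω)).toNNReal with hv
      have hvr : σ ω < r ↔ v < r := by
        rw [← ENNReal.coe_lt_coe, hv, ENNReal.coe_toNNReal hne, min_lt_iff, or_iff_right]
        exact_mod_cast not_lt.2 (hrs.trans h.le)
      rw [hvr, gridAbove, min_le_iff, or_iff_right (not_le.2 h), div_le_iff₀ (by positivity), hr,
        lt_div_iff₀ (by positivity), mul_comm s, mul_comm v]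
      rw [show ((⌊(n + 1 : ℝ≥0) * v⌋₊ : ℝ≥0) + 1) = ((⌊(n + 1 : ℝ≥0) * v⌋₊ + 1 : ℕ) : ℝ≥0) by
        push_cast; rfl, ← Nat.le_floor_iff (by positivity), Nat.succ_le_iff,
        Nat.floor_lt (by positivity)]
    rw [this]
    exact F.mono hrs _ (hσ r)

lemma countable_range_gridAbove (σ : Ω → ℝ≥0∞) (t : ℝ≥0) (n : ℕ) :
    (range fun ω => ((gridAbove t n (min (t : ℝ≥0∞) (σ ω)).toNNReal : ℝ≥0) :
      WithTop ℝ≥0)).Countable := by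
  refine (countable_range fun k : ℕ =>
    ((Min.min t ((k + 1) / (n + 1)) : ℝ≥0) : WithTop ℝ≥0)).mono ?_
  rintro _ ⟨ω, rfl⟩
  exact ⟨_, rfl⟩

/-- Optional stopping for right-continuous, locally bounded martingales. -/
lemma integral_stopped_eq [IsProbabilityMeasure P] {F : Filtration ℝ≥0 m} {M : ℝ≥0 → Ω → ℝ}
    (hM : Martingale M F P) {σ : Ω → ℝ≥0∞} (hσ : IsOptionalTime F σ) (t : ℝ≥0)
    (hrc : ∀ ω u, ContinuousWithinAt (fun u => M u ω) (Ici u) u) {C : ℝ}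
    (hC : ∀ u ≤ t, ∀ ω, |M u ω| ≤ C) :
    ∫ ω, M (min (t : ℝ≥0∞) (σ ω)).toNNReal ω ∂P = ∫ ω, M 0 ω ∂P := by
  set v : Ω → ℝ≥0 := fun ω => (min (t : ℝ≥0∞) (σ ω)).toNNReal with hv
  have hvt : ∀ ω, v ω ≤ t := fun ω => by
    have := ENNReal.toNNReal_mono (ENNReal.coe_ne_top (r := t)) (min_le_left (t : ℝ≥0∞) (σ ω))
    simpa using this
  have key : ∀ n, (fun ω => M (gridAbove t n (v ω)) ω) =ᵐ[P]
      P[M t | (isStoppingTime_gridAbove hσ t n).measurableSpace] := fun n =>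
    hM.stoppedValue_ae_eq_condExp_of_le_const_of_countable_range
      (isStoppingTime_gridAbove hσ t n) (n := t)
      (fun ω => WithTop.coe_le_coe.2 (gridAbove_le _ _ _)) (countable_range_gridAbove σ t n)
  have hint : ∀ n, ∫ ω, M (gridAbove t n (v ω)) ω ∂P = ∫ ω, M 0 ω ∂P := fun n => by
    rw [integral_congr_ae (key n), integral_condExp (isStoppingTime_gridAbove hσ t n).measurableSpace_le]
    have := hM.setIntegral_eq (zero_le : (0 : ℝ≥0) ≤ t) MeasurableSet.univ
    simpa using this.symm
  have hlim : Tendsto (fun n => ∫ ω, M (gridAbove t n (v ω)) ω ∂P) atTop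
      (𝓝 (∫ ω, M (v ω) ω ∂P)) := by
    refine tendsto_integral_of_dominated_convergence (fun _ => C) (fun n => ?_)
      (integrable_const C) (fun n => .of_forall fun ω => hC _ (gridAbove_le _ _ _) ω)
      (.of_forall fun ω => (hrc ω (v ω)).tendsto.comp (tendsto_gridAbove (hvt ω)))
    exact (integrable_condExp.congr (key n).symm).aestronglyMeasurable
  simp only [hint] at hlim
  exact (tendsto_nhds_unique tendsto_const_nhds hlim).symm

end Optional

/-! ### Stopped Dynkin formulas -/

section Dynkin

variable {Ω : Type*} {X : ℝ≥0 → Ω → ℝ≥0∞}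

/-- `g (X_s)` before time `σ`, zero afterwards. -/
def killed (g : ℝ≥0∞ → ℝ) (X : ℝ≥0 → Ω → ℝ≥0∞) (σ : Ω → ℝ≥0∞) (p : ℝ × Ω) : ℝ :=
  if ENNReal.ofReal p.1 < σ p.2 then g (X p.1.toNNReal p.2) else 0

/-- The value of `X` at time `t ∧ σ`. -/
def stoppedAt (X : ℝ≥0 → Ω → ℝ≥0∞) (σ : Ω → ℝ≥0∞) (t : ℝ) (ω : Ω) : ℝ≥0∞ :=
  X (min (ENNReal.ofReal t) (σ ω)).toNNReal ω

lemma stoppedAt_of_lt {σ : Ω → ℝ≥0∞} {t : ℝ} {ω : Ω} (h : ENNReal.ofReal t < σ ω) :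
    stoppedAt X σ t ω = X t.toNNReal ω := by
  rw [stoppedAt, min_eq_left h.le]; rfl

lemma stoppedAt_of_le {σ : Ω → ℝ≥0∞} {t : ℝ} {ω : Ω} (h : σ ω ≤ ENNReal.ofReal t) :
    stoppedAt X σ t ω = X (σ ω).toNNReal ω := by
  rw [stoppedAt, min_eq_right h]

lemma abs_killed_le {g : ℝ≥0∞ → ℝ} {C : ℝ} (hC : ∀ x, |g x| ≤ C) (σ : Ω → ℝ≥0∞) (p : ℝ × Ω) :
    |killed g X σ p| ≤ C := by
  unfold killed
  split_ifs
  · exact hC _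
  · simpa using (abs_nonneg _).trans (hC 0)

lemma setIntegral_killed (g : ℝ≥0∞ → ℝ) (X : ℝ≥0 → Ω → ℝ≥0∞) (σ : Ω → ℝ≥0∞) {t : ℝ}
    (ω : Ω) :
    ∫ s in Ioc 0 t, killed g X σ (s, ω) =
      ∫ s in (0 : ℝ)..((min (ENNReal.ofReal t) (σ ω)).toNNReal : ℝ), g (X s.toNNReal ω) := by
  set w := min (ENNReal.ofReal t) (σ ω) with hw
  have hw1 : w ≤ ENNReal.ofReal t := min_le_left _ _
  have hw2 : w ≤ σ ω := min_le_right _ _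
  have hwt : w ≠ ∞ := ne_top_of_le_ne_top ENNReal.ofReal_ne_top hw1
  set v : ℝ := (w.toNNReal : ℝ) with hv
  have hv' : ENNReal.ofReal v = w := by rw [hv, ENNReal.ofReal_coe_nnreal, ENNReal.coe_toNNReal hwt]
  have hv0 : 0 ≤ v := NNReal.coe_nonneg _
  rw [intervalIntegral.integral_of_le hv0]
  have hset : ∫ s in Ioc 0 t, killed g X σ (s, ω) =
      ∫ s in Ioc 0 t, (Iic v).indicator (fun s => g (X s.toNNReal ω)) s := by
    refine setIntegral_congr_ae measurableSet_Ioc ?_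
    filter_upwards [compl_mem_ae_iff.2 (measure_singleton v)] with s hs hst
    rcases lt_or_gt_of_ne hs with h | h
    · have : ENNReal.ofReal s < σ ω := by
        refine lt_of_lt_of_le ?_ hw2
        rw [← hv']
        exact (ENNReal.ofReal_lt_ofReal_iff (hst.1.trans h)).2 h
      simp [killed, this, h.le]
    · have h1 : w < ENNReal.ofReal s := by
        rw [← hv']
        exact (ENNReal.ofReal_lt_ofReal_iff hst.1).2 h
      have h2 : ¬ ENNReal.ofReal s < σ ω := by
        intro h3
        exact absurd (lt_min (h1.trans_le (ENNReal.ofReal_le_ofReal hst.2)) (h1.trans h3))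
          (lt_irrefl w)
      simp [killed, h2, h]
  rw [hset, setIntegral_indicator measurableSet_Iic]
  congr 2
  ext s
  simp only [mem_inter_iff, mem_Ioc, mem_Iic, and_assoc]
  refine and_congr_right fun hs => ⟨fun h => h.2, fun h => ⟨?_, h⟩⟩
  have : ENNReal.ofReal s ≤ ENNReal.ofReal t := by
    refine le_trans ?_ hw1
    rw [← hv']
    exact ENNReal.ofReal_le_ofReal h
  rcases le_total 0 t with ht | ht
  · exact (ENNReal.ofReal_le_ofReal_iff ht).1 this
  · rw [ENNReal.ofReal_of_nonpos ht, nonpos_iff_eq_zero, ENNReal.ofReal_eq_zero] at this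
    exact absurd this (not_le.2 hs)

variable [MeasurableSpace Ω] {P : Measure Ω}

/-- `𝔼 f (X_{t ∧ σ}) - 𝔼 f (X_0) = 𝔼 ∫₀^{t ∧ σ} g (X_s) ds`, with absolute convergence. -/
structure StoppedDynkin (f g : ℝ≥0∞ → ℝ) (X : ℝ≥0 → Ω → ℝ≥0∞) (σ : Ω → ℝ≥0∞)
    (P : Measure Ω) : Prop where
  integrable : ∀ t : ℝ, Integrable (killed g X σ) ((volume.restrict (Ioc 0 t)).prod P)
  integral_eq : ∀ t : ℝ, 0 ≤ t → ∫ p, killed g X σ p ∂((volume.restrict (Ioc 0 t)).prod P) =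
    ∫ ω, f (stoppedAt X σ t ω) ∂P - ∫ ω, f (X 0 ω) ∂P

lemma measurable_killed {g : ℝ≥0∞ → ℝ} (hg : Measurable g)
    (hX : Measurable fun p : ℝ≥0 × Ω => X p.1 p.2) {σ : Ω → ℝ≥0∞} (hσ : Measurable σ) :
    Measurable (killed g X σ) := by
  refine Measurable.ite (measurableSet_lt (by fun_prop) (by fun_prop)) ?_ measurable_const
  exact hg.comp (hX.comp (f := fun p : ℝ × Ω => (p.1.toNNReal, p.2)) (by fun_prop))

lemma measurable_stoppedAt (hX : Measurable fun p : ℝ≥0 × Ω => X p.1 p.2) {σ : Ω → ℝ≥0∞}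
    (hσ : Measurable σ) : Measurable fun p : ℝ × Ω => stoppedAt X σ p.1 p.2 :=
  hX.comp (f := fun p : ℝ × Ω => ((min (ENNReal.ofReal p.1) (σ p.2)).toNNReal, p.2)) (by fun_prop)

lemma StoppedDynkin.of_martingale [IsProbabilityMeasure P] {hX : ∀ t, StronglyMeasurable (X t)}
    {f g : ℝ≥0∞ → ℝ} (h : IsIntegralMartingale f g X hX P)
    (hXm : Measurable fun p : ℝ≥0 × Ω => X p.1 p.2)
    (hf : Measurable f) {B : ℝ} (hB : ∀ x, |f x| ≤ B)
    (hfX : ∀ ω u, ContinuousWithinAt (fun u => f (X u ω)) (Ici u) u)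
    (hg : Measurable g) {C : ℝ} (hC : ∀ x, |g x| ≤ C)
    {σ : Ω → ℝ≥0∞} (hσ : IsOptionalTime (Filtration.natural X hX) σ) :
    StoppedDynkin f g X σ P := by
  have hσm := hσ.measurable
  have hgX : ∀ ω, Measurable fun s : ℝ => g (X s.toNNReal ω) := fun ω =>
    hg.comp (hXm.comp (f := fun s : ℝ => (s.toNNReal, ω)) (by fun_prop))
  have hii : ∀ ω a b, IntervalIntegrable (fun s : ℝ => g (X s.toNNReal ω)) volume a b :=
    fun ω a b => (intervalIntegrable_const (c := C)).mono_fun (hgX ω).aestronglyMeasurable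
      (.of_forall fun s => by
        simpa [abs_of_nonneg ((abs_nonneg _).trans (hC 0))] using hC _)
  have hint : ∀ t : ℝ, Integrable (killed g X σ) ((volume.restrict (Ioc 0 t)).prod P) := fun t =>
    Integrable.of_bound (measurable_killed hg hXm hσm).aestronglyMeasurable C
      (.of_forall fun p => abs_killed_le hC σ p)
  refine ⟨hint, fun t ht => ?_⟩
  have hcont : ∀ ω, Continuous fun u : ℝ≥0 => ∫ s in (0 : ℝ)..(u : ℝ), g (X s.toNNReal ω) :=
    fun ω => (intervalIntegral.continuous_primitive (hii ω) 0).comp NNReal.continuous_coe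
  have hbd : ∀ (u : ℝ≥0) ω, |∫ s in (0 : ℝ)..(u : ℝ), g (X s.toNNReal ω)| ≤ C * u := fun u ω => by
    have := intervalIntegral.norm_integral_le_of_norm_le_const (a := 0) (b := (u : ℝ))
      (f := fun s : ℝ => g (X s.toNNReal ω)) (C := C) (fun s _ => hC _)
    simpa using this
  have hC0 : 0 ≤ C := (abs_nonneg _).trans (hC 0)
  have hst := integral_stopped_eq h.2 hσ t.toNNReal
    (fun ω u => (hfX ω u).sub (hcont ω).continuousWithinAt) (C := B + C * t.toNNReal)
    (fun u hu ω => (abs_sub _ _).trans (add_le_add (hB _) ((hbd u ω).trans (by gcongr))))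
  rw [integral_prod_symm _ (hint t)]
  simp only [setIntegral_killed]
  have h0 : ∫ ω, (f (X 0 ω) - ∫ s in (0 : ℝ)..((0 : ℝ≥0) : ℝ), g (X s.toNNReal ω)) ∂P
      = ∫ ω, f (X 0 ω) ∂P := by simp
  rw [h0] at hst
  have hI2 : Integrable (fun ω => ∫ s in Ioc 0 t, killed g X σ (s, ω)) P :=
    (hint t).integral_prod_right
  simp only [setIntegral_killed] at hI2
  have hI1 : Integrable (fun ω => f (stoppedAt X σ t ω)) P :=
    Integrable.of_bound (hf.comp ((measurable_stoppedAt hXm hσm).comp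
      (f := fun ω => (t, ω)) (by fun_prop))).aestronglyMeasurable B (.of_forall fun ω => hB _)
  have hsub := integral_sub hI1 hI2
  have : ∫ ω, (f (stoppedAt X σ t ω) -
      ∫ s in (0 : ℝ)..((min (ENNReal.ofReal t) (σ ω)).toNNReal : ℝ), g (X s.toNNReal ω)) ∂P = ∫ ω, f (X 0 ω) ∂P := hst
  rw [this] at hsub
  linarith

end Dynkin

/-! ### Fubini for a kernel with one-sided integrability -/

section Fubini

variable {α β : Type*} [MeasurableSpace α] [MeasurableSpace β] {μ : Measure α} {ν : Measure β}

lemma integrable_prod_of_posPart [IsFiniteMeasure μ] [IsFiniteMeasure ν] {J : α × β → ℝ}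
    (hJ : Measurable J) {B : ℝ}
    (hs : ∀ᵐ b ∂ν, Integrable (fun a => J (a, b)) μ ∧ |∫ a, J (a, b) ∂μ| ≤ B)
    (hp : ∫⁻ p, ENNReal.ofReal (J p) ∂(μ.prod ν) < ∞) : Integrable J (μ.prod ν) := by
  refine ⟨hJ.aestronglyMeasurable, ?_⟩
  rw [hasFiniteIntegral_iff_norm, lintegral_prod_symm _ (by fun_prop)]
  rw [lintegral_prod_symm _ (by fun_prop)] at hp
  have hle : ∀ᵐ b ∂ν, ∫⁻ a, ENNReal.ofReal ‖J (a, b)‖ ∂μ ≤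
      2 * ∫⁻ a, ENNReal.ofReal (J (a, b)) ∂μ + ENNReal.ofReal B := by
    filter_upwards [hs] with b ⟨hb, hbB⟩
    have hpos : Integrable (fun a => max (J (a, b)) 0) μ := hb.pos_part
    have e : ∀ a, ‖J (a, b)‖ = 2 * max (J (a, b)) 0 - J (a, b) := fun a => by
      rw [Real.norm_eq_abs]
      rcases le_total 0 (J (a, b)) with h | h
      · rw [abs_of_nonneg h, max_eq_left h]; ring
      · rw [abs_of_nonpos h, max_eq_right h]; ring
    rw [← ofReal_integral_eq_lintegral_ofReal hb.norm (.of_forall fun a => norm_nonneg _)]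
    simp only [e]
    rw [integral_sub (hpos.const_mul 2) hb, integral_const_mul]
    have h2 : ∫⁻ a, ENNReal.ofReal (J (a, b)) ∂μ = ENNReal.ofReal (∫ a, max (J (a, b)) 0 ∂μ) := by
      rw [ofReal_integral_eq_lintegral_ofReal hpos (.of_forall fun a => le_max_right _ _)]
      simp [ENNReal.ofReal_max]
    rw [h2, show (2 : ℝ≥0∞) = ENNReal.ofReal 2 by simp, ← ENNReal.ofReal_mul zero_le_two]
    refine le_trans (ENNReal.ofReal_le_ofReal ?_) ENNReal.ofReal_add_le
    linarith [neg_abs_le (∫ a, J (a, b) ∂μ)]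
  refine (lintegral_mono_ae hle).trans_lt ?_
  have hm : Measurable fun b => ∫⁻ a, ENNReal.ofReal (J (a, b)) ∂μ :=
    Measurable.lintegral_prod_left' (f := fun p : α × β => ENNReal.ofReal (J p)) (by fun_prop)
  rw [lintegral_add_left (hm.const_mul 2), lintegral_const_mul _ hm, lintegral_const]
  exact ENNReal.add_lt_top.2 ⟨ENNReal.mul_lt_top (by simp) hp,
    ENNReal.mul_lt_top ENNReal.ofReal_lt_top (measure_lt_top _ _)⟩

end Fubini

section Triangle

variable {Ω Ω' : Type*} {X : ℝ≥0 → Ω → ℝ≥0∞} {Y : ℝ≥0 → Ω' → ℝ≥0∞}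

/-- `φ (X_u, Y_v)` on `{u + v ≤ T, u < σ, v < τ}`, zero elsewhere. -/
def triangleKernel (φ : ℝ≥0∞ → ℝ≥0∞ → ℝ) (X : ℝ≥0 → Ω → ℝ≥0∞) (σ : Ω → ℝ≥0∞)
    (Y : ℝ≥0 → Ω' → ℝ≥0∞) (τ : Ω' → ℝ≥0∞) (T : ℝ) (p : (ℝ × Ω) × (ℝ × Ω')) : ℝ :=
  if p.1.1 + p.2.1 ≤ T ∧ ENNReal.ofReal p.1.1 < σ p.1.2 ∧ ENNReal.ofReal p.2.1 < τ p.2.2 then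
    φ (X p.1.1.toNNReal p.1.2) (Y p.2.1.toNNReal p.2.2) else 0

variable [MeasurableSpace Ω] [MeasurableSpace Ω'] {P : Measure Ω} {Q : Measure Ω'}
  {σ : Ω → ℝ≥0∞} {τ : Ω' → ℝ≥0∞}

lemma measurable_triangleKernel {φ : ℝ≥0∞ → ℝ≥0∞ → ℝ}
    (hφ : Measurable fun p : ℝ≥0∞ × ℝ≥0∞ => φ p.1 p.2)
    (hX : Measurable fun p : ℝ≥0 × Ω => X p.1 p.2) (hY : Measurable fun p : ℝ≥0 × Ω' => Y p.1 p.2)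
    (hσ : Measurable σ) (hτ : Measurable τ) (T : ℝ) :
    Measurable (triangleKernel φ X σ Y τ T) := by
  have h1 : MeasurableSet {p : (ℝ × Ω) × (ℝ × Ω') | p.1.1 + p.2.1 ≤ T} :=
    measurableSet_le (by fun_prop) measurable_const
  have h2 : MeasurableSet {p : (ℝ × Ω) × (ℝ × Ω') | ENNReal.ofReal p.1.1 < σ p.1.2} :=
    measurableSet_lt (by fun_prop) (by fun_prop)
  have h3 : MeasurableSet {p : (ℝ × Ω) × (ℝ × Ω') | ENNReal.ofReal p.2.1 < τ p.2.2} :=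
    measurableSet_lt (by fun_prop) (by fun_prop)
  exact Measurable.ite (h1.inter (h2.inter h3)) (hφ.comp (Measurable.prodMk
    (hX.comp (f := fun p : (ℝ × Ω) × (ℝ × Ω') => (p.1.1.toNNReal, p.1.2)) (by fun_prop))
    (hY.comp (f := fun p : (ℝ × Ω) × (ℝ × Ω') => (p.2.1.toNNReal, p.2.2)) (by fun_prop))))
    measurable_const

lemma lintegral_triangleKernel_lt_top [IsProbabilityMeasure P] [IsProbabilityMeasure Q]
    {φ : ℝ≥0∞ → ℝ≥0∞ → ℝ}
    (hφ : Measurable fun p : ℝ≥0∞ × ℝ≥0∞ => φ p.1 p.2)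
    (hX : Measurable fun p : ℝ≥0 × Ω => X p.1 p.2) (hY : Measurable fun p : ℝ≥0 × Ω' => Y p.1 p.2)
    (hσ : Measurable σ) (hτ : Measurable τ) (h : StoppedIntegrablePos φ X σ P Y τ Q)
    {T : ℝ} (hT : 0 ≤ T) :
    ∫⁻ p, ENNReal.ofReal (triangleKernel φ X σ Y τ T p)
      ∂(((volume.restrict (Ioc 0 T)).prod P).prod ((volume.restrict (Ioc 0 T)).prod Q)) < ∞ := by
  have hJ := (measurable_triangleKernel hφ hX hY hσ hτ T).ennreal_ofReal
  obtain ⟨J, hJd⟩ : ∃ J, J = fun p => ENNReal.ofReal (triangleKernel φ X σ Y τ T p) := ⟨_, rfl⟩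
  simp only [← hJd] at hJ
  simp only [← congrFun hJd]
  have h1 : ∀ v : ℝ, ∫⁻ ω', ∫⁻ p, J (p, (v, ω')) ∂((volume.restrict (Ioc 0 T)).prod P) ∂Q =
      ∫⁻ u in Ioc 0 T, ∫⁻ ω, J ((u, ω.1), (v, ω.2)) ∂(P.prod Q) := fun v => by
    have e1 : ∀ ω', ∫⁻ p, J (p, (v, ω')) ∂((volume.restrict (Ioc 0 T)).prod P) =
        ∫⁻ u in Ioc 0 T, ∫⁻ ω, J ((u, ω), (v, ω')) ∂P := fun ω' => by
      rw [lintegral_prod (fun p : ℝ × Ω => J (p, (v, ω'))) (by fun_prop)]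
    simp only [e1]
    rw [lintegral_lintegral_swap]
    · refine lintegral_congr fun u => ?_
      rw [lintegral_prod_symm (fun ω : Ω × Ω' => J ((u, ω.1), (v, ω.2))) (by fun_prop)]
    · refine Measurable.aemeasurable ?_
      exact Measurable.lintegral_prod_right'
        (f := fun q : (Ω' × ℝ) × Ω => J ((q.1.2, q.2), (v, q.1.1))) (by fun_prop)
  rw [lintegral_prod_symm _ hJ.aemeasurable, lintegral_prod _
    (Measurable.lintegral_prod_left' hJ).aemeasurable]
  simp only [h1]
  refine lt_of_le_of_lt ?_ (h T hT)
  refine (lintegral_mono_set Ioc_subset_Icc_self).trans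
    (setLIntegral_mono' measurableSet_Icc fun v hv => ?_)
  refine (lintegral_mono_set Ioc_subset_Icc_self).trans
    (setLIntegral_mono' measurableSet_Icc fun u hu => ?_)
  by_cases huv : u + v ∈ Icc 0 T
  · rw [indicator_of_mem huv]
    refine lintegral_mono fun ω => ?_
    simp only [hJd, triangleKernel]
    split_ifs with hc
    · rw [min_eq_left hc.2.1.le, min_eq_left hc.2.2.le]; rfl
    · simp
  · rw [indicator_of_notMem huv]
    refine le_of_eq ((lintegral_congr fun ω => ?_).trans lintegral_zero)
    simp only [hJd, triangleKernel]
    split_ifs with hc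
    · exact absurd ⟨add_nonneg hu.1 hv.1, hc.1⟩ huv
    · simp

end Triangle

section Gap

variable {Ω Ω' : Type*} {X : ℝ≥0 → Ω → ℝ≥0∞} {Y : ℝ≥0 → Ω' → ℝ≥0∞} {σ : Ω → ℝ≥0∞}
  {τ : Ω' → ℝ≥0∞}

/-- The increment of the duality kernel along `X` before `τ` minus the increment along `Y`
before `σ`. -/
def dualityGap (X : ℝ≥0 → Ω → ℝ≥0∞) (σ : Ω → ℝ≥0∞) (x₀ : ℝ≥0∞) (Y : ℝ≥0 → Ω' → ℝ≥0∞)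
    (τ : Ω' → ℝ≥0∞) (y₀ : ℝ≥0∞) (s r : ℝ) (ω : Ω × Ω') : ℝ :=
  (if ENNReal.ofReal r < τ ω.2 then
    expKernel (stoppedAt X σ s ω.1) (Y r.toNNReal ω.2) - expKernel x₀ (Y r.toNNReal ω.2) else 0) -
  (if ENNReal.ofReal s < σ ω.1 then
    expKernel (X s.toNNReal ω.1) (stoppedAt Y τ r ω.2) - expKernel (X s.toNNReal ω.1) y₀ else 0)

lemma abs_expKernel_sub_le (x y x' y' : ℝ≥0∞) : |expKernel x y - expKernel x' y'| ≤ 1 :=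
  abs_sub_le_of_nonneg_of_le (expKernel_nonneg _ _) (expKernel_le_one _ _)
    (expKernel_nonneg _ _) (expKernel_le_one _ _)

lemma abs_ite_expKernel_sub_le (p : Prop) [Decidable p] (x y x' y' : ℝ≥0∞) :
    |if p then expKernel x y - expKernel x' y' else 0| ≤ 1 := by
  split_ifs
  · exact abs_expKernel_sub_le _ _ _ _
  · simp

lemma abs_dualityGap_le (x₀ y₀ : ℝ≥0∞) (s r : ℝ) (ω : Ω × Ω') :
    |dualityGap X σ x₀ Y τ y₀ s r ω| ≤ 2 :=
  (abs_sub _ _).trans ((add_le_add (abs_ite_expKernel_sub_le _ _ _ _ _)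
    (abs_ite_expKernel_sub_le _ _ _ _ _)).trans (by norm_num))

lemma dualityGap_eq_sub (x₀ y₀ : ℝ≥0∞) (s r : ℝ) (ω : Ω × Ω') :
    dualityGap X σ x₀ Y τ y₀ s r ω =
      (if ENNReal.ofReal r < τ ω.2 then expKernel (stoppedAt X σ s ω.1) (Y r.toNNReal ω.2)
        - expKernel x₀ (Y r.toNNReal ω.2) else 0) -
      (if ENNReal.ofReal s < σ ω.1 then expKernel (stoppedAt Y τ r ω.2) (X s.toNNReal ω.1)
        - expKernel y₀ (X s.toNNReal ω.1) else 0) := by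
  simp only [dualityGap, expKernel_comm (X s.toNNReal ω.1)]

lemma triangleKernel_swap (φ : ℝ≥0∞ → ℝ≥0∞ → ℝ) (T : ℝ) (p : (ℝ × Ω) × (ℝ × Ω')) :
    triangleKernel (fun y x => φ x y) Y τ X σ T p.swap = triangleKernel φ X σ Y τ T p := by
  simp only [triangleKernel, Prod.fst_swap, Prod.snd_swap, add_comm p.2.1, and_comm]

variable [MeasurableSpace Ω] {P : Measure Ω}

lemma prod_restrict_Ioc_cut [SFinite P] {r T : ℝ} (hr : r ≤ T) :
    ((volume.restrict (Ioc 0 T)).prod P).restrict {p : ℝ × Ω | p.1 ≤ r} =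
      (volume.restrict (Ioc 0 r)).prod P := by
  have : {p : ℝ × Ω | p.1 ≤ r} = Iic r ×ˢ univ := by ext; simp
  rw [this, ← Measure.prod_restrict, Measure.restrict_univ, Measure.restrict_restrict
    measurableSet_Iic, inter_comm, Ioc_inter_Iic, inf_of_le_right hr]

lemma StoppedDynkin.integrable_cut [SFinite P] {f g : ℝ≥0∞ → ℝ} (h : StoppedDynkin f g X σ P)
    {r T : ℝ} (hr : r ≤ T) :
    Integrable ({p : ℝ × Ω | p.1 ≤ r}.indicator (killed g X σ))
      ((volume.restrict (Ioc 0 T)).prod P) := by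
  rw [integrable_indicator_iff (measurableSet_le measurable_fst measurable_const), IntegrableOn,
    prod_restrict_Ioc_cut hr]
  exact h.integrable r

lemma StoppedDynkin.integral_cut [SFinite P] {f g : ℝ≥0∞ → ℝ} (h : StoppedDynkin f g X σ P)
    {r T : ℝ} (h0 : 0 ≤ r) (hr : r ≤ T) :
    ∫ p, {p : ℝ × Ω | p.1 ≤ r}.indicator (killed g X σ) p
      ∂((volume.restrict (Ioc 0 T)).prod P) =
    ∫ ω, f (stoppedAt X σ r ω) ∂P - ∫ ω, f (X 0 ω) ∂P := by
  rw [integral_indicator (measurableSet_le measurable_fst measurable_const),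
    prod_restrict_Ioc_cut hr, h.integral_eq r h0]

/-- The mean increment of the duality kernel along `X` up to time `s ∧ σ`, when `Y` is at its
position at time `q.1 < τ`. -/
def meanIncrement (X : ℝ≥0 → Ω → ℝ≥0∞) (σ : Ω → ℝ≥0∞) (P : Measure Ω) (x₀ : ℝ≥0∞)
    (Y : ℝ≥0 → Ω' → ℝ≥0∞) (τ : Ω' → ℝ≥0∞) (s : ℝ) (q : ℝ × Ω') : ℝ :=
  if ENNReal.ofReal q.1 < τ q.2 then
    ∫ ω, expKernel (stoppedAt X σ s ω) (Y q.1.toNNReal q.2) ∂P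
      - expKernel x₀ (Y q.1.toNNReal q.2) else 0

lemma abs_meanIncrement_le [IsProbabilityMeasure P] (x₀ : ℝ≥0∞) (s : ℝ) (q : ℝ × Ω') :
    |meanIncrement X σ P x₀ Y τ s q| ≤ 1 := by
  unfold meanIncrement
  split_ifs
  · refine abs_sub_le_of_nonneg_of_le (integral_nonneg fun ω => expKernel_nonneg _ _) ?_
      (expKernel_nonneg _ _) (expKernel_le_one _ _)
    refine (integral_mono_of_nonneg (.of_forall fun ω => expKernel_nonneg _ _)
      (integrable_const (1 : ℝ)) (.of_forall fun ω => expKernel_le_one _ _)).trans ?_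
    simp
  · simp

lemma integral_triangleKernel_left [IsProbabilityMeasure P] {φ : ℝ≥0∞ → ℝ≥0∞ → ℝ} {x₀ : ℝ≥0∞}
    (hX0 : ∀ᵐ ω ∂P, X 0 ω = x₀) {T : ℝ} {q : ℝ × Ω'} (hq : q.1 ∈ Ioc 0 T)
    (h : ENNReal.ofReal q.1 < τ q.2 → StoppedDynkin (fun x => expKernel x (Y q.1.toNNReal q.2))
      (fun x => φ x (Y q.1.toNNReal q.2)) X σ P) :
    Integrable (fun p => triangleKernel φ X σ Y τ T (p, q)) ((volume.restrict (Ioc 0 T)).prod P) ∧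
    ∫ p, triangleKernel φ X σ Y τ T (p, q) ∂((volume.restrict (Ioc 0 T)).prod P) =
      meanIncrement X σ P x₀ Y τ (T - q.1) q := by
  unfold meanIncrement
  by_cases hc : ENNReal.ofReal q.1 < τ q.2
  · have e : (fun p => triangleKernel φ X σ Y τ T (p, q)) = {p : ℝ × Ω | p.1 ≤ T - q.1}.indicator
        (killed (fun x => φ x (Y q.1.toNNReal q.2)) X σ) := by
      ext p
      simp only [triangleKernel, hc, and_true, indicator_apply, mem_ofPred_eq, killed,
        le_sub_iff_add_le, ite_and]
    have hx : ∫ ω, expKernel (X 0 ω) (Y q.1.toNNReal q.2) ∂P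
        = expKernel x₀ (Y q.1.toNNReal q.2) := by
      rw [integral_congr_ae (g := fun _ => expKernel x₀ (Y q.1.toNNReal q.2))]
      · simp
      · filter_upwards [hX0] with ω hω
        rw [hω]
    rw [e, if_pos hc, ← hx]
    exact ⟨(h hc).integrable_cut (by linarith [hq.1]),
      (h hc).integral_cut (by linarith [hq.2]) (by linarith [hq.1])⟩
  · simp [triangleKernel, hc]

variable [MeasurableSpace Ω'] {Q : Measure Ω'}

lemma integrable_triangleKernel [IsProbabilityMeasure P] [IsProbabilityMeasure Q]
    {φ : ℝ≥0∞ → ℝ≥0∞ → ℝ} (hφ : Measurable fun p : ℝ≥0∞ × ℝ≥0∞ => φ p.1 p.2)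
    (hX : Measurable fun p : ℝ≥0 × Ω => X p.1 p.2) (hY : Measurable fun p : ℝ≥0 × Ω' => Y p.1 p.2)
    (hσ : Measurable σ) (hτ : Measurable τ) {T : ℝ} (hT : 0 ≤ T) {B : ℝ}
    (hs : ∀ᵐ q ∂(volume.restrict (Ioc 0 T)).prod Q,
      Integrable (fun p => triangleKernel φ X σ Y τ T (p, q))
        ((volume.restrict (Ioc 0 T)).prod P) ∧
      |∫ p, triangleKernel φ X σ Y τ T (p, q) ∂((volume.restrict (Ioc 0 T)).prod P)| ≤ B)
    (h : StoppedIntegrable φ X σ P Y τ Q) :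
    Integrable (triangleKernel φ X σ Y τ T)
      (((volume.restrict (Ioc 0 T)).prod P).prod ((volume.restrict (Ioc 0 T)).prod Q)) := by
  have hm := measurable_triangleKernel hφ hX hY hσ hτ T
  rcases h with h | h
  · exact integrable_prod_of_posPart hm hs
      (lintegral_triangleKernel_lt_top hφ hX hY hσ hτ h hT)
  · have e : triangleKernel (fun x y => -φ x y) X σ Y τ T = fun p =>
        -triangleKernel φ X σ Y τ T p := by
      ext p; unfold triangleKernel; split_ifs <;> simp
    have h2 := lintegral_triangleKernel_lt_top (φ := fun x y => -φ x y) hφ.neg hX hY hσ hτ h hT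
    rw [e] at h2
    have := integrable_prod_of_posPart (B := B) hm.neg ?_ h2
    · simpa using this.neg
    · filter_upwards [hs] with q ⟨hq1, hq2⟩
      exact ⟨hq1.neg, by simpa [integral_neg] using hq2⟩

lemma measurable_gapLeft (hX : Measurable fun p : ℝ≥0 × Ω => X p.1 p.2)
    (hY : Measurable fun p : ℝ≥0 × Ω' => Y p.1 p.2) (hσ : Measurable σ) (hτ : Measurable τ)
    (x₀ : ℝ≥0∞) : Measurable fun p : ℝ × ℝ × Ω × Ω' => if ENNReal.ofReal p.2.1 < τ p.2.2.2 then
      expKernel (stoppedAt X σ p.1 p.2.2.1) (Y p.2.1.toNNReal p.2.2.2)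
        - expKernel x₀ (Y p.2.1.toNNReal p.2.2.2) else 0 := by
  have h1 : Measurable fun p : ℝ × ℝ × Ω × Ω' => stoppedAt X σ p.1 p.2.2.1 :=
    (measurable_stoppedAt hX hσ).comp (f := fun p : ℝ × ℝ × Ω × Ω' => (p.1, p.2.2.1)) (by fun_prop)
  have h2 : Measurable fun p : ℝ × ℝ × Ω × Ω' => Y p.2.1.toNNReal p.2.2.2 :=
    hY.comp (f := fun p : ℝ × ℝ × Ω × Ω' => (p.2.1.toNNReal, p.2.2.2)) (by fun_prop)
  exact Measurable.ite (measurableSet_lt (by fun_prop) (by fun_prop))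
    ((h1.expKernel h2).sub (measurable_const.expKernel h2)) measurable_const

lemma measurable_dualityGap (hX : Measurable fun p : ℝ≥0 × Ω => X p.1 p.2)
    (hY : Measurable fun p : ℝ≥0 × Ω' => Y p.1 p.2) (hσ : Measurable σ) (hτ : Measurable τ)
    (x₀ y₀ : ℝ≥0∞) : Measurable fun p : ℝ × ℝ × Ω × Ω' =>
      dualityGap X σ x₀ Y τ y₀ p.1 p.2.1 p.2.2 := by
  simp only [dualityGap_eq_sub]
  exact (measurable_gapLeft hX hY hσ hτ x₀).sub ((measurable_gapLeft hY hX hτ hσ y₀).comp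
    (f := fun p : ℝ × ℝ × Ω × Ω' => (p.2.1, p.1, p.2.2.2, p.2.2.1)) (by fun_prop))

/-- The mean of `dualityGap`, integrated out one process at a time. -/
lemma integral_dualityGap [IsProbabilityMeasure P] [IsProbabilityMeasure Q]
    (hX : Measurable fun p : ℝ≥0 × Ω => X p.1 p.2) (hY : Measurable fun p : ℝ≥0 × Ω' => Y p.1 p.2)
    (hσ : Measurable σ) (hτ : Measurable τ) (x₀ y₀ : ℝ≥0∞) (s r : ℝ) :
    ∫ ω, dualityGap X σ x₀ Y τ y₀ s r ω ∂(P.prod Q) =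
      ∫ ω', meanIncrement X σ P x₀ Y τ s (r, ω') ∂Q -
        ∫ ω, meanIncrement Y τ Q y₀ X σ r (s, ω) ∂P := by
  have h1 : Integrable (fun ω : Ω × Ω' => if ENNReal.ofReal r < τ ω.2 then
      expKernel (stoppedAt X σ s ω.1) (Y r.toNNReal ω.2) - expKernel x₀ (Y r.toNNReal ω.2) else 0)
      (P.prod Q) :=
    Integrable.of_bound ((measurable_gapLeft hX hY hσ hτ x₀).comp
      (f := fun ω : Ω × Ω' => (s, r, ω)) (by fun_prop)).aestronglyMeasurable 1
      (.of_forall fun ω => abs_ite_expKernel_sub_le _ _ _ _ _)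
  have h2 : Integrable (fun ω : Ω × Ω' => if ENNReal.ofReal s < σ ω.1 then
      expKernel (stoppedAt Y τ r ω.2) (X s.toNNReal ω.1) - expKernel y₀ (X s.toNNReal ω.1) else 0)
      (P.prod Q) :=
    Integrable.of_bound ((measurable_gapLeft hY hX hτ hσ y₀).comp
      (f := fun ω : Ω × Ω' => (r, s, ω.2, ω.1)) (by fun_prop)).aestronglyMeasurable 1
      (.of_forall fun ω => abs_ite_expKernel_sub_le _ _ _ _ _)
  have mX : Measurable fun ω => stoppedAt X σ s ω :=
    (measurable_stoppedAt hX hσ).comp (f := fun ω => (s, ω)) (by fun_prop)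
  have mY : Measurable fun ω => stoppedAt Y τ r ω :=
    (measurable_stoppedAt hY hτ).comp (f := fun ω => (r, ω)) (by fun_prop)
  simp only [dualityGap_eq_sub]
  rw [integral_sub h1 h2, integral_prod_symm _ h1, integral_prod _ h2]
  congr 1
  · refine integral_congr_ae (.of_forall fun ω' => ?_)
    by_cases hc : ENNReal.ofReal r < τ ω'
    · simp only [meanIncrement, hc, if_true]
      rw [integral_sub (Integrable.of_bound (mX.expKernel measurable_const).aestronglyMeasurable 1
        (.of_forall fun ω => abs_expKernel_le_one _ _)) (integrable_const _)]
      simp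
    · simp [meanIncrement, hc]
  · refine integral_congr_ae (.of_forall fun ω => ?_)
    by_cases hc : ENNReal.ofReal s < σ ω
    · simp only [meanIncrement, hc, if_true]
      rw [integral_sub (Integrable.of_bound (mY.expKernel measurable_const).aestronglyMeasurable 1
        (.of_forall fun ω => abs_expKernel_le_one _ _)) (integrable_const _)]
      simp
    · simp [meanIncrement, hc]

lemma integral_dualityGap_eq_zero [IsProbabilityMeasure P] [IsProbabilityMeasure Q]
    {φ : ℝ≥0∞ → ℝ≥0∞ → ℝ} (hφ : Measurable fun p : ℝ≥0∞ × ℝ≥0∞ => φ p.1 p.2)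
    (hX : Measurable fun p : ℝ≥0 × Ω => X p.1 p.2) (hY : Measurable fun p : ℝ≥0 × Ω' => Y p.1 p.2)
    (hσ : Measurable σ) (hτ : Measurable τ) {x₀ y₀ : ℝ≥0∞}
    (hX0 : ∀ᵐ ω ∂P, X 0 ω = x₀) (hY0 : ∀ᵐ ω ∂Q, Y 0 ω = y₀)
    (hXd : ∀ᵐ q ∂(volume : Measure ℝ).prod Q, ENNReal.ofReal q.1 < τ q.2 →
      StoppedDynkin (fun x => expKernel x (Y q.1.toNNReal q.2))
        (fun x => φ x (Y q.1.toNNReal q.2)) X σ P)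
    (hYd : ∀ᵐ p ∂(volume : Measure ℝ).prod P, ENNReal.ofReal p.1 < σ p.2 →
      StoppedDynkin (fun y => expKernel y (X p.1.toNNReal p.2))
        (fun y => φ (X p.1.toNNReal p.2) y) Y τ Q)
    (h : StoppedIntegrable φ X σ P Y τ Q) {T : ℝ} (hT : 0 ≤ T) :
    ∫ s in (0 : ℝ)..T, ∫ ω, dualityGap X σ x₀ Y τ y₀ s (T - s) ω ∂(P.prod Q) = 0 := by
  have hIoc : ∀ᵐ s ∂(volume.restrict (Ioc 0 T)), s ∈ Ioc 0 T := ae_restrict_mem measurableSet_Ioc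
  have hQac : (volume.restrict (Ioc 0 T)).prod Q ≪ volume.prod Q :=
    Measure.AbsolutelyContinuous.prod Measure.restrict_le_self.absolutelyContinuous .rfl
  have hPac : (volume.restrict (Ioc 0 T)).prod P ≪ volume.prod P :=
    Measure.AbsolutelyContinuous.prod Measure.restrict_le_self.absolutelyContinuous .rfl
  have hR : ∀ᵐ q ∂(volume.restrict (Ioc 0 T)).prod Q,
      Integrable (fun p => triangleKernel φ X σ Y τ T (p, q))
        ((volume.restrict (Ioc 0 T)).prod P) ∧
      ∫ p, triangleKernel φ X σ Y τ T (p, q) ∂((volume.restrict (Ioc 0 T)).prod P) =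
        meanIncrement X σ P x₀ Y τ (T - q.1) q := by
    filter_upwards [hQac.ae_le hXd, Measure.quasiMeasurePreserving_fst.ae hIoc] with q h1 h2
    exact integral_triangleKernel_left hX0 h2 h1
  have hL : ∀ᵐ p ∂(volume.restrict (Ioc 0 T)).prod P,
      ∫ q, triangleKernel φ X σ Y τ T (p, q) ∂((volume.restrict (Ioc 0 T)).prod Q) =
        meanIncrement Y τ Q y₀ X σ (T - p.1) p := by
    filter_upwards [hPac.ae_le hYd, Measure.quasiMeasurePreserving_fst.ae hIoc] with p h1 h2
    rw [← (integral_triangleKernel_left (φ := fun y x => φ x y) hY0 h2 h1).2]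
    exact integral_congr_ae (.of_forall fun q => (triangleKernel_swap φ T (p, q)).symm)
  have hJ := integrable_triangleKernel (B := 1) hφ hX hY hσ hτ hT (by
    filter_upwards [hR] with q ⟨hq1, hq2⟩
    exact ⟨hq1, hq2 ▸ abs_meanIncrement_le _ _ _⟩) h
  have e1 := integral_prod_symm _ hJ
  rw [integral_prod _ hJ] at e1
  have hRi := hJ.integral_prod_right.congr (hR.mono fun q hq => hq.2)
  have hLi := hJ.integral_prod_left.congr hL
  rw [integral_congr_ae hL, integral_congr_ae (hR.mono fun q hq => hq.2),
    integral_prod _ hRi, integral_prod _ hLi, ← intervalIntegral.integral_of_le hT,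
    ← intervalIntegral.integral_of_le hT] at e1
  have hRi' := (intervalIntegrable_iff_integrableOn_Ioc_of_le hT).2 hRi.integral_prod_left
  have hLi' := (intervalIntegrable_iff_integrableOn_Ioc_of_le hT).2 hLi.integral_prod_left
  have hRc := hRi'.comp_sub_left T
  simp only [sub_self, sub_zero] at hRc
  have e2 := intervalIntegral.integral_sub hRc.symm hLi'
  have e3 := intervalIntegral.integral_comp_sub_left (a := 0) (b := T)
    (fun v => ∫ ω', meanIncrement X σ P x₀ Y τ (T - v) (v, ω') ∂Q) T
  simp only [sub_self, sub_zero] at e3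
  rw [e3, e1, sub_self] at e2
  simp only [sub_sub_cancel] at e2
  simpa only [integral_dualityGap hX hY hσ hτ] using e2

end Gap

/-! ### Hitting times of open sets -/

/-- `inf {t : f_t ∈ S}`. -/
def hitTime (S : Set ℝ≥0∞) (f : ℝ≥0 → ℝ≥0∞) : ℝ≥0∞ := ⨅ (t : ℝ≥0) (_ : f t ∈ S), (t : ℝ≥0∞)

lemma passageAbove_eq_hitTime (m : ℝ≥0∞) (f : ℝ≥0 → ℝ≥0∞) :
    passageAbove m f = hitTime (Ioi m) f := rfl

lemma passageBelow_eq_hitTime (ε : ℝ≥0∞) (f : ℝ≥0 → ℝ≥0∞) :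
    passageBelow ε f = hitTime (Iio ε) f := rfl

lemma hitTime_union (S T : Set ℝ≥0∞) (f : ℝ≥0 → ℝ≥0∞) :
    hitTime (S ∪ T) f = min (hitTime S f) (hitTime T f) := by
  simp [hitTime, iInf_or, iInf_inf_eq]

lemma hitTime_anti {S T : Set ℝ≥0∞} (h : S ⊆ T) (f : ℝ≥0 → ℝ≥0∞) : hitTime T f ≤ hitTime S f :=
  le_iInf₂ fun t ht => iInf₂_le t (h ht)

lemma hitTime_le {S : Set ℝ≥0∞} {f : ℝ≥0 → ℝ≥0∞} {t : ℝ≥0} (h : f t ∈ S) : hitTime S f ≤ t :=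
  iInf₂_le t h

lemma apply_hitTime_mem_closure {S : Set ℝ≥0∞} {f : ℝ≥0 → ℝ≥0∞}
    (hf : ∀ t, ContinuousWithinAt f (Ici t) t) (h : hitTime S f ≠ ∞) :
    f (hitTime S f).toNNReal ∈ closure S := by
  by_contra hc
  set a := (hitTime S f).toNNReal with ha
  have ha' : (a : ℝ≥0∞) = hitTime S f := ENNReal.coe_toNNReal h
  have hev : ∀ᶠ t in 𝓝[≥] a, f t ∈ (closure S)ᶜ :=
    (hf a).eventually (isClosed_closure.isOpen_compl.mem_nhds hc)
  obtain ⟨b, hab, hb⟩ := (mem_nhdsGE_iff_exists_Ico_subset).1 hev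
  have : (b : ℝ≥0∞) ≤ hitTime S f := by
    refine le_iInf₂ fun t ht => ?_
    have hat : a ≤ t := by
      rw [← ENNReal.coe_le_coe, ha']; exact hitTime_le ht
    by_contra hlt
    exact hb ⟨hat, by exact_mod_cast not_le.1 hlt⟩ (subset_closure ht)
  rw [← ha', ENNReal.coe_le_coe] at this
  exact absurd hab (not_lt.2 this)

lemma isOptionalTime_hitTime {Ω : Type*} [MeasurableSpace Ω] {X : ℝ≥0 → Ω → ℝ≥0∞}
    (hX : ∀ t, StronglyMeasurable (X t))
    (hc : ∀ ω t, ContinuousWithinAt (fun t => X t ω) (Ici t) t) {S : Set ℝ≥0∞} (hS : IsOpen S) :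
    IsOptionalTime (Filtration.natural X hX) fun ω => hitTime S fun t => X t ω := by
  intro t
  have : {ω | hitTime S (fun t => X t ω) < t} =
      ⋃ q : {q : ℚ // (q : ℝ).toNNReal < t}, X (q.1 : ℝ).toNNReal ⁻¹' S := by
    ext ω
    simp only [mem_ofPred_eq, hitTime, iInf_lt_iff, mem_iUnion, mem_preimage, exists_prop,
      ENNReal.coe_lt_coe]
    constructor
    · rintro ⟨u, hu, hut⟩
      have hev : ∀ᶠ s in 𝓝[≥] u, X s ω ∈ S := (hc ω u).eventually (hS.mem_nhds hu)
      obtain ⟨b, hub, hb⟩ := (mem_nhdsGE_iff_exists_Ico_subset).1 hev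
      obtain ⟨q, -, h1, h2⟩ := (NNReal.lt_iff_exists_rat_btwn _ _).1 (lt_min hub hut)
      exact ⟨⟨q, h2.trans_le (min_le_right _ _)⟩, hb ⟨h1.le, h2.trans_le (min_le_left _ _)⟩⟩
    · rintro ⟨q, hq⟩
      exact ⟨_, hq, q.2⟩
  rw [this]
  refine MeasurableSet.iUnion fun q => (Filtration.natural X hX).mono q.2.le _ ?_
  exact (Filtration.stronglyAdapted_natural hX _).measurable hS.measurableSet

/-! ### Minimal paths -/

lemma IsMinimalAt.eq_of_eq {b : ℝ≥0∞} {f : ℝ≥0 → ℝ≥0∞} (hf : IsMinimalAt b f) {t u : ℝ≥0}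
    (ht : f t = b) (htu : t ≤ u) : f u = b :=
  hf.2 u ((iInf₂_le t (Or.inr ht)).trans (by exact_mod_cast htu))

lemma leftLim_eq {f : ℝ≥0 → ℝ≥0∞} {t : ℝ≥0} (ht : 0 < t) {b : ℝ≥0∞}
    (h : Tendsto f (𝓝[<] t) (𝓝 b)) : Function.leftLim f t = b := by
  have : (𝓝[<] t).NeBot := nhdsLT_neBot_of_exists_lt ⟨0, ht⟩
  exact leftLim_eq_of_tendsto h

lemma IsMinimalAt.eq_of_leftLim {b : ℝ≥0∞} {f : ℝ≥0 → ℝ≥0∞} (hf : IsMinimalAt b f) {t u : ℝ≥0}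
    (ht : Function.leftLim f t = b) (htu : t ≤ u) : f u = b :=
  hf.2 u ((iInf₂_le t (Or.inl ht)).trans (by exact_mod_cast htu))

lemma IsMinimalAt.continuousWithinAt_expKernel {f : ℝ≥0 → ℝ≥0∞} (hf : IsMinimalAt ∞ f) (y : ℝ≥0∞)
    (t : ℝ≥0) : ContinuousWithinAt (fun t => expKernel (f t) y) (Ici t) t := by
  by_cases h : f t = ∞
  · refine (continuousWithinAt_const (b := (0 : ℝ))).congr (fun u hu => ?_) ?_
    · rw [hf.eq_of_eq h hu, expKernel_top_left]
    · rw [h, expKernel_top_left]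
  · exact (continuousAt_expKernel_left (y := y) (Or.inr h)).comp_continuousWithinAt (hf.1 t).1

/-- Alternative for the hitting times of a decreasing sequence of sets by a càdlàg path. -/
lemma hitTime_alternative {f : ℝ≥0 → ℝ≥0∞} (hf : IsCadlag f) {S : ℕ → Set ℝ≥0∞} (hS : Antitone S)
    (r : ℝ≥0) :
    (∀ᶠ k in atTop, (r : ℝ≥0∞) < hitTime (S k) f) ∨
    ((∀ k, hitTime (S k) f ≤ r) ∧ ∃ ζ ≤ r, ∃ L,
      Tendsto (fun k => f (hitTime (S k) f).toNNReal) atTop (𝓝 L) ∧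
      ((L = f ζ ∧ ∀ᶠ k in atTop, (hitTime (S k) f).toNNReal = ζ) ∨
        (Function.leftLim f ζ = L ∧ ∀ t < ζ, ∃ k, (t : ℝ≥0∞) < hitTime (S k) f))) := by
  have hmono : Monotone fun k => hitTime (S k) f := fun i j hij => hitTime_anti (hS hij) f
  by_cases h : ∃ k, (r : ℝ≥0∞) < hitTime (S k) f
  · obtain ⟨k, hk⟩ := h
    exact Or.inl ((eventually_ge_atTop k).mono fun j hj => hk.trans_le (hmono hj))
  push Not at h
  refine Or.inr ⟨h, ?_⟩
  have hne : ∀ k, hitTime (S k) f ≠ ∞ := fun k => ne_top_of_le_ne_top ENNReal.coe_ne_top (h k)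
  set z : ℕ → ℝ≥0 := fun k => (hitTime (S k) f).toNNReal with hz
  have hzc : ∀ k, (z k : ℝ≥0∞) = hitTime (S k) f := fun k => ENNReal.coe_toNNReal (hne k)
  have hzm : Monotone z := fun i j hij => ENNReal.toNNReal_mono (hne j) (hmono hij)
  have hzr : ∀ k, z k ≤ r := fun k => by rw [← ENNReal.coe_le_coe, hzc]; exact h k
  have hbdd : BddAbove (range z) := ⟨r, by rintro _ ⟨k, rfl⟩; exact hzr k⟩
  have hlim := tendsto_atTop_ciSup hzm hbdd
  set ζ := ⨆ k, z k with hζ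
  have hle : ∀ k, z k ≤ ζ := le_ciSup hbdd
  refine ⟨ζ, ciSup_le hzr, ?_⟩
  by_cases hc : ∃ k, z k = ζ
  · obtain ⟨k, hk⟩ := hc
    have hev : ∀ᶠ j in atTop, z j = ζ :=
      (eventually_ge_atTop k).mono fun j hj => le_antisymm (hle j) (hk ▸ hzm hj)
    exact ⟨f ζ, tendsto_const_nhds.congr' (hev.mono fun j hj => congrArg f hj.symm), Or.inl ⟨rfl, hev⟩⟩
  · push Not at hc
    have hlt : ∀ k, z k < ζ := fun k => lt_of_le_of_ne (hle k) (hc k)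
    obtain ⟨L, hL⟩ := (hf ζ).2
    refine ⟨L, hL.comp (tendsto_nhdsWithin_iff.2 ⟨hlim, .of_forall hlt⟩), Or.inr
      ⟨leftLim_eq ((zero_le).trans_lt (hlt 0)) hL, fun t ht => ?_⟩⟩
    obtain ⟨k, hk⟩ := (hlim.eventually (lt_mem_nhds ht)).exists
    exact ⟨k, by rw [← hzc]; exact_mod_cast hk⟩

lemma IsMinimalAt.eq_of_alternative {f : ℝ≥0 → ℝ≥0∞} {b L : ℝ≥0∞} (hf : IsMinimalAt b f)
    {ζ r : ℝ≥0} (hζ : ζ ≤ r) (hL : L = b) (h : L = f ζ ∨ Function.leftLim f ζ = L) : f r = b := by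
  rcases h with h | h
  · exact hf.eq_of_eq (h.symm.trans hL) hζ
  · exact hf.eq_of_leftLim (h.trans hL) hζ

/-- Passage times above large levels: either time `r` is not reached, or the path has exploded. -/
lemma passageAbove_alternative {f : ℝ≥0 → ℝ≥0∞} (hf : IsMinimalAt ∞ f) (r : ℝ≥0) :
    (∀ᶠ k : ℕ in atTop, (r : ℝ≥0∞) < passageAbove ((k + 1 : ℕ) : ℝ≥0∞) f) ∨
    ((∀ k : ℕ, passageAbove ((k + 1 : ℕ) : ℝ≥0∞) f ≤ r) ∧
      Tendsto (fun k : ℕ => f (passageAbove ((k + 1 : ℕ) : ℝ≥0∞) f).toNNReal) atTop (𝓝 ∞) ∧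
      f r = ∞) := by
  have hS : Antitone fun k : ℕ => Ioi ((k + 1 : ℕ) : ℝ≥0∞) := fun i j hij =>
    Ioi_subset_Ioi (by exact_mod_cast Nat.succ_le_succ hij)
  rcases hitTime_alternative hf.1 hS r with h | ⟨h1, ζ, hζ, L, hL, h2⟩
  · exact Or.inl h
  · have hge : ∀ k : ℕ, ((k + 1 : ℕ) : ℝ≥0∞) ≤
        f (hitTime (Ioi ((k + 1 : ℕ) : ℝ≥0∞)) f).toNNReal := fun k =>
      closure_minimal Ioi_subset_Ici_self isClosed_Ici (apply_hitTime_mem_closure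
        (fun t => (hf.1 t).1) (ne_top_of_le_ne_top ENNReal.coe_ne_top (h1 k)))
    have htop : Tendsto (fun k : ℕ => f (hitTime (Ioi ((k + 1 : ℕ) : ℝ≥0∞)) f).toNNReal)
        atTop (𝓝 ∞) :=
      tendsto_nhds_top_mono (ENNReal.tendsto_nat_nhds_top.comp (tendsto_add_atTop_nat 1))
        (.of_forall hge)
    exact Or.inr ⟨h1, htop, hf.eq_of_alternative hζ (tendsto_nhds_unique hL htop)
      (h2.imp And.left And.left)⟩

/-- The level `(k + 1)⁻¹`. -/
def level (k : ℕ) : ℝ≥0 := ((k : ℝ≥0) + 1)⁻¹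

lemma level_pos (k : ℕ) : 0 < level k := by unfold level; positivity

lemma level_anti : Antitone level := fun i j hij => by
  unfold level
  gcongr

lemma tendsto_level : Tendsto level atTop (𝓝 0) := by
  simpa [show level = fun k : ℕ => ((k : ℝ≥0) + 1)⁻¹ from rfl] using tendsto_one_div_add_atTop_nhds_zero_nat (𝕜 := ℝ≥0)

lemma tendsto_coe_level : Tendsto (fun k => (level k : ℝ≥0∞)) atTop (𝓝 0) := by
  simpa using ENNReal.tendsto_coe.2 tendsto_level

/-- Passage times below small levels: either time `r` is not reached, or the path has reached
zero. -/
lemma passageBelow_alternative {f : ℝ≥0 → ℝ≥0∞} (hf : IsMinimalAt 0 f) (r : ℝ≥0) :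
    (∀ᶠ k : ℕ in atTop, (r : ℝ≥0∞) < passageBelow (level k) f) ∨
    ((∀ k : ℕ, passageBelow (level k) f ≤ r) ∧
      Tendsto (fun k : ℕ => f (passageBelow (level k) f).toNNReal) atTop (𝓝 0) ∧ f r = 0) := by
  have hS : Antitone fun k : ℕ => Iio (level k : ℝ≥0∞) := fun i j hij =>
    Iio_subset_Iio (by exact_mod_cast level_anti hij)
  rcases hitTime_alternative hf.1 hS r with h | ⟨h1, ζ, hζ, L, hL, h2⟩
  · exact Or.inl h
  · have hge : ∀ k : ℕ, f (hitTime (Iio (level k : ℝ≥0∞)) f).toNNReal ≤ level k := fun k =>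
      closure_minimal Iio_subset_Iic_self isClosed_Iic (apply_hitTime_mem_closure
        (fun t => (hf.1 t).1) (ne_top_of_le_ne_top ENNReal.coe_ne_top (h1 k)))
    have htop : Tendsto (fun k : ℕ => f (hitTime (Iio (level k : ℝ≥0∞)) f).toNNReal)
        atTop (𝓝 0) :=
      tendsto_of_tendsto_of_tendsto_of_le_of_le tendsto_const_nhds tendsto_coe_level
        (fun _ => zero_le) hge
    exact Or.inr ⟨h1, htop, hf.eq_of_alternative hζ (tendsto_nhds_unique hL htop)
      (h2.imp And.left And.left)⟩

/-- Exit times from `[(k + 1)⁻¹, k + 1]` for a path that does not explode continuously. -/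
lemma exit_alternative {f : ℝ≥0 → ℝ≥0∞} (hf : IsMinimalAt ∞ f) (hf0 : IsMinimalAt 0 f)
    (hne : NoContinuousExplosion f) (r : ℝ≥0) :
    (∀ᶠ k : ℕ in atTop, (r : ℝ≥0∞) <
      min (passageAbove ((k + 1 : ℕ) : ℝ≥0∞) f) (passageBelow (level k) f)) ∨
    ((∀ k : ℕ, min (passageAbove ((k + 1 : ℕ) : ℝ≥0∞) f) (passageBelow (level k) f) ≤ r) ∧
      ((Tendsto (fun k : ℕ => f (min (passageAbove ((k + 1 : ℕ) : ℝ≥0∞) f)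
          (passageBelow (level k) f)).toNNReal) atTop (𝓝 0) ∧ f r = 0) ∨
        ((∀ᶠ k : ℕ in atTop, f (min (passageAbove ((k + 1 : ℕ) : ℝ≥0∞) f)
          (passageBelow (level k) f)).toNNReal = ∞) ∧ f r = ∞))) := by
  simp only [passageAbove_eq_hitTime, passageBelow_eq_hitTime, ← hitTime_union]
  have hS : Antitone fun k : ℕ => Ioi ((k + 1 : ℕ) : ℝ≥0∞) ∪ Iio (level k : ℝ≥0∞) := fun i j hij =>
    union_subset_union (Ioi_subset_Ioi (by exact_mod_cast Nat.succ_le_succ hij))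
      (Iio_subset_Iio (by exact_mod_cast level_anti hij))
  rcases hitTime_alternative hf.1 hS r with h | ⟨h1, ζ, hζ, L, hL, h2⟩
  · exact Or.inl h
  refine Or.inr ⟨h1, ?_⟩
  have hmem : ∀ k : ℕ, f (hitTime (Ioi ((k + 1 : ℕ) : ℝ≥0∞) ∪ Iio (level k : ℝ≥0∞)) f).toNNReal ∈
      Ici ((k + 1 : ℕ) : ℝ≥0∞) ∪ Iic (level k : ℝ≥0∞) := fun k =>
    closure_minimal (union_subset_union Ioi_subset_Ici_self Iio_subset_Iic_self)
      (isClosed_Ici.union isClosed_Iic) (apply_hitTime_mem_closure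
        (fun t => (hf.1 t).1) (ne_top_of_le_ne_top ENNReal.coe_ne_top (h1 k)))
  have hL' : L = 0 ∨ L = ∞ := by
    by_contra! hcon
    obtain ⟨N, hN⟩ := ENNReal.exists_nat_gt hcon.2
    obtain ⟨c, hc0, hcL⟩ := exists_between (pos_iff_ne_zero.2 hcon.1)
    obtain ⟨k, ⟨⟨hk1, hk2⟩, hk3⟩, hk4⟩ := (((hL.eventually (gt_mem_nhds hN)).and
      (hL.eventually (lt_mem_nhds hcL))).and (eventually_ge_atTop N)).and
      (tendsto_coe_level.eventually (gt_mem_nhds hc0)) |>.exists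
    rcases hmem k with h | h
    · refine absurd (lt_of_le_of_lt h hk1) (not_lt.2 ?_)
      exact_mod_cast hk3.trans (Nat.le_succ k)
    · exact absurd (hk4.trans (hk2.trans_le h)) (lt_irrefl _)
  rcases hL' with h0 | htop
  · exact Or.inl ⟨h0 ▸ hL, hf0.eq_of_alternative hζ h0 (h2.imp And.left And.left)⟩
  · refine Or.inr ⟨?_, hf.eq_of_alternative hζ htop (h2.imp And.left And.left)⟩
    rcases h2 with ⟨h2, h3⟩ | ⟨h2, h3⟩
    · filter_upwards [h3] with k hk
      rw [hk, ← h2, htop]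
    · exfalso
      have hle : explosionTime ∞ f ≤ ζ := iInf₂_le ζ (Or.inl (h2.trans htop))
      have heq : explosionTime ∞ f = ζ := by
        refine le_antisymm hle (le_iInf₂ fun t ht => ?_)
        by_contra hlt
        obtain ⟨k, hk⟩ := h3 t (by exact_mod_cast not_le.1 hlt)
        have hft : f t = ∞ := hf.2 t (iInf₂_le t ht)
        exact absurd (hitTime_le (S := Ioi ((k + 1 : ℕ) : ℝ≥0∞) ∪ Iio (level k : ℝ≥0∞))
          (Or.inl (by rw [hft]; exact ENNReal.natCast_lt_top _))) (not_le.2 hk)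
      have := hne (heq ▸ ENNReal.coe_lt_top)
      rw [heq, ENNReal.toNNReal_coe] at this
      exact this (h2.trans htop)

/-! ### Passing to the limit -/

section Limit

lemma eq_zero_of_integral_eq_zero {G : ℝ → ℝ} (hi : ∀ t, IntervalIntegrable G volume 0 t)
    (hm : StronglyMeasurable G) (h : ∀ t, 0 ≤ t → ∫ s in (0 : ℝ)..t, G s = 0) {t : ℝ} (ht : 0 ≤ t)
    (hc : ContinuousWithinAt G (Ioi t) t) : G t = 0 := by
  have h1 : HasDerivWithinAt (fun u => ∫ s in (0 : ℝ)..u, G s) (G t) (Ici t) t :=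
    intervalIntegral.integral_hasDerivWithinAt_right (hi t)
      hm.stronglyMeasurableAtFilter hc
  have h2 : HasDerivWithinAt (fun u => ∫ s in (0 : ℝ)..u, G s) 0 (Ici t) t :=
    (hasDerivWithinAt_const t (Ici t) (0 : ℝ)).congr (fun u hu => h u (ht.trans hu)) (h t ht)
  exact (uniqueDiffOn_Ici t t self_mem_Ici).eq_deriv _ h1 h2

variable {Ω Ω' : Type*} [MeasurableSpace Ω] [MeasurableSpace Ω'] {P : Measure Ω} {Q : Measure Ω'}
  {X : ℝ≥0 → Ω → ℝ≥0∞} {Y : ℝ≥0 → Ω' → ℝ≥0∞}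

lemma measurable_expKernel_process (hX : Measurable fun p : ℝ≥0 × Ω => X p.1 p.2) (y : ℝ≥0∞) :
    Measurable fun p : ℝ × Ω => expKernel (X p.1.toNNReal p.2) y :=
  (hX.comp (f := fun p : ℝ × Ω => (p.1.toNNReal, p.2)) (by fun_prop)).expKernel measurable_const

lemma stronglyMeasurable_integral_expKernel [SFinite P]
    (hX : Measurable fun p : ℝ≥0 × Ω => X p.1 p.2) (y : ℝ≥0∞) :
    StronglyMeasurable fun t : ℝ => ∫ ω, expKernel (X t.toNNReal ω) y ∂P :=
  (measurable_expKernel_process hX y).stronglyMeasurable.integral_prod_right'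

lemma abs_integral_expKernel_le [IsProbabilityMeasure P] (Z : Ω → ℝ≥0∞) (y : ℝ≥0∞) :
    |∫ ω, expKernel (Z ω) y ∂P| ≤ 1 := by
  have := norm_integral_le_of_norm_le_const (μ := P) (f := fun ω => expKernel (Z ω) y)
    (.of_forall fun ω => abs_expKernel_le_one _ _)
  simpa using this

lemma intervalIntegrable_integral_expKernel [IsProbabilityMeasure P]
    (hX : Measurable fun p : ℝ≥0 × Ω => X p.1 p.2) (y : ℝ≥0∞) (a b : ℝ) :
    IntervalIntegrable (fun t : ℝ => ∫ ω, expKernel (X t.toNNReal ω) y ∂P) volume a b :=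
  (intervalIntegrable_const (c := (1 : ℝ))).mono_fun
    (stronglyMeasurable_integral_expKernel hX y).aestronglyMeasurable
    (.of_forall fun t => by simpa using abs_integral_expKernel_le _ _)

lemma continuousWithinAt_integral_expKernel [IsProbabilityMeasure P]
    (hX : Measurable fun p : ℝ≥0 × Ω => X p.1 p.2) {y : ℝ≥0∞}
    (hc : ∀ ω t, ContinuousWithinAt (fun t => expKernel (X t ω) y) (Ici t) t) (t : ℝ) :
    ContinuousWithinAt (fun t : ℝ => ∫ ω, expKernel (X t.toNNReal ω) y ∂P) (Ioi t) t := by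
  refine tendsto_integral_filter_of_dominated_convergence (fun _ => 1)
    (.of_forall fun s => ((measurable_expKernel_process hX y).comp
      (f := fun ω => (s, ω)) (by fun_prop)).aestronglyMeasurable)
    (.of_forall fun s => .of_forall fun ω => abs_expKernel_le_one _ _) (integrable_const _)
    (.of_forall fun ω => ?_)
  refine (hc ω t.toNNReal).tendsto.comp (tendsto_nhdsWithin_iff.2
    ⟨continuous_real_toNNReal.continuousAt.mono_left nhdsWithin_le_nhds, ?_⟩)
  filter_upwards [self_mem_nhdsWithin] with s hs
  exact Real.toNNReal_le_toNNReal (le_of_lt hs)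

/-- Duality follows once the duality gaps along a sequence of times have mean zero and converge to
the difference of the two sides. -/
lemma duality_of_tendsto_dualityGap [IsProbabilityMeasure P] [IsProbabilityMeasure Q]
    (hX : Measurable fun p : ℝ≥0 × Ω => X p.1 p.2) (hY : Measurable fun p : ℝ≥0 × Ω' => Y p.1 p.2)
    {σ : ℕ → Ω → ℝ≥0∞} {τ : ℕ → Ω' → ℝ≥0∞} (hσ : ∀ k, Measurable (σ k))
    (hτ : ∀ k, Measurable (τ k)) {x₀ y₀ : ℝ≥0∞}
    (hcX : ∀ ω t, ContinuousWithinAt (fun t => expKernel (X t ω) y₀) (Ici t) t)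
    (hcY : ∀ ω t, ContinuousWithinAt (fun t => expKernel (Y t ω) x₀) (Ici t) t)
    (hgap : ∀ k, ∀ T : ℝ, 0 ≤ T →
      ∫ s in (0 : ℝ)..T, ∫ ω, dualityGap X (σ k) x₀ Y (τ k) y₀ s (T - s) ω ∂(P.prod Q) = 0)
    (hlim : ∀ s r : ℝ, 0 ≤ s → 0 ≤ r → ∀ᵐ ω ∂P.prod Q,
      Tendsto (fun k => dualityGap X (σ k) x₀ Y (τ k) y₀ s r ω) atTop
        (𝓝 (expKernel (X s.toNNReal ω.1) y₀ - expKernel x₀ (Y r.toNNReal ω.2)))) (t : ℝ≥0) :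
    ∫ ω, expKernel (X t ω) y₀ ∂P = ∫ ω, expKernel x₀ (Y t ω) ∂Q := by
  set p : ℝ → ℝ := fun t => ∫ ω, expKernel (X t.toNNReal ω) y₀ ∂P with hp
  set q : ℝ → ℝ := fun t => ∫ ω, expKernel (Y t.toNNReal ω) x₀ ∂Q with hq
  have hpi := intervalIntegrable_integral_expKernel (P := P) hX y₀
  have hqi := intervalIntegrable_integral_expKernel (P := Q) hY x₀
  have hpm := stronglyMeasurable_integral_expKernel (P := P) hX y₀
  have hqm := stronglyMeasurable_integral_expKernel (P := Q) hY x₀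
  have hm : ∀ k (s r : ℝ), Measurable fun ω => dualityGap X (σ k) x₀ Y (τ k) y₀ s r ω :=
    fun k s r => (measurable_dualityGap hX hY (hσ k) (hτ k) x₀ y₀).comp
      (f := fun ω : Ω × Ω' => (s, r, ω)) (by fun_prop)
  have hpt : ∀ s r : ℝ, 0 ≤ s → 0 ≤ r →
      Tendsto (fun k => ∫ ω, dualityGap X (σ k) x₀ Y (τ k) y₀ s r ω ∂(P.prod Q)) atTop
        (𝓝 (p s - q r)) := by
    intro s r hs hr
    have h1 : Integrable (fun ω : Ω × Ω' => expKernel (X s.toNNReal ω.1) y₀) (P.prod Q) :=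
      Integrable.of_bound ((measurable_expKernel_process hX y₀).comp
        (f := fun ω : Ω × Ω' => (s, ω.1)) (by fun_prop)).aestronglyMeasurable 1
        (.of_forall fun ω => abs_expKernel_le_one _ _)
    have h2 : Integrable (fun ω : Ω × Ω' => expKernel (Y r.toNNReal ω.2) x₀) (P.prod Q) :=
      Integrable.of_bound ((measurable_expKernel_process hY x₀).comp
        (f := fun ω : Ω × Ω' => (r, ω.2)) (by fun_prop)).aestronglyMeasurable 1
        (.of_forall fun ω => abs_expKernel_le_one _ _)
    have e : p s - q r = ∫ ω : Ω × Ω',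
        (expKernel (X s.toNNReal ω.1) y₀ - expKernel x₀ (Y r.toNNReal ω.2)) ∂(P.prod Q) := by
      simp only [expKernel_comm x₀]
      rw [integral_sub h1 h2, integral_fun_fst (fun ω => expKernel (X s.toNNReal ω) y₀),
        integral_fun_snd (fun ω => expKernel (Y r.toNNReal ω) x₀)]
      simp [hp, hq]
    rw [e]
    exact tendsto_integral_of_dominated_convergence (fun _ => 2)
      (fun k => (hm k s r).aestronglyMeasurable) (integrable_const _)
      (fun k => .of_forall fun ω => abs_dualityGap_le _ _ _ _ _) (hlim s r hs hr)
  have hT : ∀ T : ℝ, 0 ≤ T → ∫ s in (0 : ℝ)..T, (p s - q (T - s)) = 0 := by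
    intro T hT
    have := intervalIntegral.tendsto_integral_filter_of_dominated_convergence
      (μ := volume) (a := 0) (b := T) (l := atTop)
      (F := fun k s => ∫ ω, dualityGap X (σ k) x₀ Y (τ k) y₀ s (T - s) ω ∂(P.prod Q))
      (f := fun s => p s - q (T - s)) (fun _ => (2 : ℝ)) (.of_forall fun k => ?_)
      (.of_forall fun k => .of_forall fun s _ => ?_) intervalIntegrable_const
      (.of_forall fun s hs => ?_)
    · simp only [hgap _ T hT] at this
      exact (tendsto_nhds_unique tendsto_const_nhds this).symm
    · refine StronglyMeasurable.aestronglyMeasurable ?_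
      exact StronglyMeasurable.integral_prod_right'
        (f := fun p : ℝ × (Ω × Ω') => dualityGap X (σ k) x₀ Y (τ k) y₀ p.1 (T - p.1) p.2)
        ((measurable_dualityGap hX hY (hσ k) (hτ k) x₀ y₀).comp
          (f := fun p : ℝ × (Ω × Ω') => (p.1, T - p.1, p.2)) (by fun_prop)).stronglyMeasurable
    · have := norm_integral_le_of_norm_le_const (μ := P.prod Q)
        (f := fun ω => dualityGap X (σ k) x₀ Y (τ k) y₀ s (T - s) ω) (C := 2)
        (.of_forall fun ω => abs_dualityGap_le _ _ _ _ _)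
      simpa using this
    · rw [uIoc_of_le hT] at hs
      exact hpt s (T - s) hs.1.le (sub_nonneg.2 hs.2)
  have hT' : ∀ T : ℝ, 0 ≤ T → ∫ s in (0 : ℝ)..T, (p s - q s) = 0 := by
    intro T h0
    have hc := (hqi 0 T).comp_sub_left T
    simp only [sub_self, sub_zero] at hc
    have e1 := hT T h0
    have e3 := intervalIntegral.integral_comp_sub_left (a := 0) (b := T) q T
    simp only [sub_self, sub_zero] at e3
    rw [intervalIntegral.integral_sub (hpi 0 T) hc.symm, e3] at e1
    rwa [intervalIntegral.integral_sub (hpi 0 T) (hqi 0 T)]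
  have key := eq_zero_of_integral_eq_zero (G := fun s => p s - q s)
    (fun t => (hpi 0 t).sub (hqi 0 t)) (hpm.sub hqm) hT' t.2
    ((continuousWithinAt_integral_expKernel hX hcX t).sub
      (continuousWithinAt_integral_expKernel hY hcY t))
  have hfin := sub_eq_zero.1 key
  simp only [hp, hq, NNReal.val_eq_coe, Real.toNNReal_coe] at hfin
  simpa only [expKernel_comm x₀] using hfin

end Limit

/-! ### Solutions of the martingale problem -/

section Solutions

variable {Ω : Type*} [MeasurableSpace Ω] {P : Measure Ω} {X : ℝ≥0 → Ω → ℝ≥0∞}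

lemma IsMPSolution.measurable_uncurry {A : Set ((ℝ≥0∞ → ℝ) × (ℝ≥0∞ → ℝ))} {μ : Measure ℝ≥0∞}
    (hX : IsMPSolution A μ X P) : Measurable fun p : ℝ≥0 × Ω => X p.1 p.2 := by
  have hn : ∀ n : ℕ, Measurable fun p : ℝ≥0 × Ω => X (min p.1 n) p.2 := by
    intro n
    have h1 : Measurable fun p : Iic (n : ℝ≥0) × Ω => X p.1 p.2 :=
      (hX.progressive n).measurable.mono
        (sup_le_sup le_rfl (MeasurableSpace.comap_mono ((Filtration.natural X _).le _))) le_rfl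
    exact h1.comp (f := fun p : ℝ≥0 × Ω => (⟨min p.1 n, mem_Iic.2 (min_le_right _ _)⟩, p.2))
      (((by fun_prop : Measurable fun p : ℝ≥0 × Ω => min p.1 (n : ℝ≥0)).subtype_mk).prodMk
        measurable_snd)
  refine measurable_of_tendsto_metrizable hn (tendsto_pi_nhds.2 fun p => ?_)
  obtain ⟨N, hN⟩ := exists_nat_ge p.1
  refine tendsto_const_nhds.congr' ?_
  filter_upwards [eventually_ge_atTop N] with n hn
  rw [min_eq_left (hN.trans (by exact_mod_cast hn))]

lemma IsMPSolution.ae_zero_eq {A : Set ((ℝ≥0∞ → ℝ) × (ℝ≥0∞ → ℝ))} {x₀ : ℝ≥0∞}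
    (hX : IsMPSolution A (Measure.dirac x₀) X P) : ∀ᵐ ω ∂P, X 0 ω = x₀ := by
  have h : ∀ᵐ x ∂(P.map (X 0)), x = x₀ := by
    rw [hX.initialLaw]
    exact (ae_dirac_iff (p := fun x => x = x₀) (measurableSet_singleton x₀)).2 rfl
  exact ae_of_ae_map (hX.stronglyMeasurable 0).measurable.aemeasurable h

lemma IsMPSolution.ae_eq_of_start {A : Set ((ℝ≥0∞ → ℝ) × (ℝ≥0∞ → ℝ))} {b : ℝ≥0∞}
    (hX : IsMPSolution A (Measure.dirac b) X P) (hp : ∀ ω, IsMinimalAt b fun t => X t ω) (t : ℝ≥0) :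
    ∀ᵐ ω ∂P, X t ω = b := by
  filter_upwards [hX.ae_zero_eq] with ω hω using (hp ω).eq_of_eq (u := t) hω zero_le

lemma stoppedDynkin_zero [SFinite P] (σ : Ω → ℝ≥0∞) : StoppedDynkin (fun _ => 0) (fun _ => 0) X σ P := by
  have : killed (fun _ => 0) X σ = fun _ => 0 := by ext; simp [killed]
  exact ⟨fun t => by simp [this], fun t _ => by simp [this]⟩

lemma IsMPSolution.stoppedDynkin [IsProbabilityMeasure P] {ψ : ℝ≥0∞ → ℝ≥0∞ → ℝ}
    (hψ : IsLaplaceDualSymbol ψ) (hv : VanishesAtInfinity ψ) {μ : Measure ℝ≥0∞}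
    (hX : IsMPSolution (pregenerator ψ) μ X P) (hp : ∀ ω, IsMinimalAt ∞ fun t => X t ω)
    {σ : Ω → ℝ≥0∞} (hσ : IsOptionalTime (Filtration.natural X hX.stronglyMeasurable) σ)
    {y : ℝ≥0∞} (hy : y ≠ 0) :
    StoppedDynkin (fun x => expKernel x y) (fun x => phi ψ x y) X σ P := by
  rcases eq_or_ne y ∞ with rfl | hy'
  · simpa using stoppedDynkin_zero (P := P) (X := X) σ
  obtain ⟨C, hC⟩ := hψ.dual.exists_abs_phi_le_left hy
  simp only [phi_dual] at hC
  exact .of_martingale (hX.martingale _ (mem_pregenerator hψ hv hy hy')) hX.measurable_uncurry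
    (measurable_id.expKernel measurable_const) (fun x => abs_expKernel_le_one x y)
    (fun ω u => (hp ω).continuousWithinAt_expKernel y u)
    (hψ.measurable_phi.comp (f := fun x => (x, y)) (by fun_prop)) hC hσ

lemma IsMPSolution.stoppedDynkin_dual [IsProbabilityMeasure P] {ψ : ℝ≥0∞ → ℝ≥0∞ → ℝ}
    (hψ : IsLaplaceDualSymbol ψ) (hv : VanishesAtInfinity ψ) {μ : Measure ℝ≥0∞}
    (hX : IsMPSolution (pregenerator (dual ψ)) μ X P) (hp : ∀ ω, IsMinimalAt ∞ fun t => X t ω)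
    {σ : Ω → ℝ≥0∞} (hσ : IsOptionalTime (Filtration.natural X hX.stronglyMeasurable) σ)
    {y : ℝ≥0∞} (hy : y ≠ 0) :
    StoppedDynkin (fun x => expKernel x y) (fun x => phi ψ y x) X σ P := by
  simpa only [phi_dual] using hX.stoppedDynkin hψ.dual hv.dual hp hσ hy

lemma ae_prod_ne [SFinite P] (hX : Measurable fun p : ℝ≥0 × Ω => X p.1 p.2) {b : ℝ≥0∞}
    (h : ∀ t, ∀ᵐ ω ∂P, X t ω ≠ b) :
    ∀ᵐ p ∂(volume : Measure ℝ).prod P, X p.1.toNNReal p.2 ≠ b := by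
  rw [Measure.ae_prod_iff_ae_ae]
  · exact .of_forall fun t => h t.toNNReal
  · exact (hX.comp (f := fun p : ℝ × Ω => (p.1.toNNReal, p.2)) (by fun_prop))
      (measurableSet_singleton b).compl

lemma le_of_lt_passageBelow {ε : ℝ≥0∞} {f : ℝ≥0 → ℝ≥0∞} {t : ℝ≥0}
    (h : (t : ℝ≥0∞) < passageBelow ε f) : ε ≤ f t :=
  not_lt.1 fun hlt => absurd (hitTime_le (S := Iio ε) hlt) (not_le.2 h)

lemma le_of_lt_passageAbove {m : ℝ≥0∞} {f : ℝ≥0 → ℝ≥0∞} {t : ℝ≥0}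
    (h : (t : ℝ≥0∞) < passageAbove m f) : f t ≤ m :=
  not_lt.1 fun hlt => absurd (hitTime_le (S := Ioi m) hlt) (not_le.2 h)

/-- The Dynkin formula for the indicator of `[0,∞)` from the corresponding martingale problem. -/
lemma stoppedDynkin_indicator [IsProbabilityMeasure P] {ψ : ℝ≥0∞ → ℝ≥0∞ → ℝ}
    (hψ : IsLaplaceDualSymbol ψ) (hX : ∀ t, StronglyMeasurable (X t))
    (hXm : Measurable fun p : ℝ≥0 × Ω => X p.1 p.2)
    (h : IsIntegralMartingale (fun y => if y < ∞ then 1 else 0) (fun y => phi ψ 0 y) X hX P)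
    (h0 : ∀ t, ∀ᵐ ω ∂P, X t ω ≠ 0) :
    StoppedDynkin (fun y => expKernel y 0) (fun y => phi ψ 0 y) X (fun _ => ∞) P := by
  have hk : killed (fun y => phi ψ 0 y) X (fun _ => ∞) =
      fun p : ℝ × Ω => phi ψ 0 (X p.1.toNNReal p.2) := by ext p; simp [killed]
  have hf : (fun y : ℝ≥0∞ => if y < ∞ then (1 : ℝ) else 0) = fun y => expKernel y 0 := by
    ext y
    rcases eq_or_ne y ∞ with rfl | hy
    · simp
    · simp [hy.lt_top, expKernel_zero_right hy]
  rw [hf] at h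
  obtain ⟨h1, h2⟩ := h
  have hm : Measurable fun p : ℝ × Ω => phi ψ 0 (X p.1.toNNReal p.2) :=
    hψ.measurable_phi.comp (f := fun p : ℝ × Ω => ((0 : ℝ≥0∞), X p.1.toNNReal p.2))
      (measurable_const.prodMk (hXm.comp (f := fun p : ℝ × Ω => (p.1.toNNReal, p.2)) (by fun_prop)))
  have hfi : ∀ t : ℝ≥0, Integrable (fun ω => expKernel (X t ω) 0) P := fun t =>
    Integrable.of_bound ((hX t).measurable.expKernel measurable_const).aestronglyMeasurable 1
      (.of_forall fun ω => abs_expKernel_le_one _ _)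
  have hGi : ∀ t : ℝ≥0, Integrable
      (fun ω => ∫ s in (0 : ℝ)..(t : ℝ), phi ψ 0 (X s.toNNReal ω)) P := fun t => by
    have := (hfi t).sub (h2.integrable t)
    refine this.congr (.of_forall fun ω => ?_)
    simp
  have hne : ∀ᵐ ω ∂P, ∀ᵐ s ∂(volume : Measure ℝ), X s.toNNReal ω ≠ 0 := by
    have := ae_prod_ne hXm h0
    have h3 := (Measure.measurePreserving_swap (μ := P) (ν := (volume : Measure ℝ))).quasiMeasurePreserving.ae this
    exact Measure.ae_ae_of_ae_prod h3
  have hint : ∀ t : ℝ≥0, Integrable (fun p : ℝ × Ω => phi ψ 0 (X p.1.toNNReal p.2))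
      ((volume.restrict (Ioc 0 (t : ℝ))).prod P) := by
    intro t
    rw [integrable_prod_iff' hm.aestronglyMeasurable]
    refine ⟨?_, (hGi t).neg.congr ?_⟩
    · filter_upwards [h1 t] with ω hω
      exact (intervalIntegrable_iff_integrableOn_Ioc_of_le t.coe_nonneg).1 hω
    · filter_upwards [hne] with ω hω
      rw [Pi.neg_apply, intervalIntegral.integral_of_le t.coe_nonneg, ← integral_neg]
      refine integral_congr_ae (ae_restrict_of_ae ?_)
      filter_upwards [hω] with s hs
      rw [Real.norm_eq_abs, abs_of_nonpos (hψ.phi_zero_nonpos hs)]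
  refine ⟨fun t => ?_, fun t ht => ?_⟩
  · rw [hk]
    rcases le_total 0 t with ht | ht
    · exact hint ⟨t, ht⟩
    · simp [Ioc_eq_empty_of_le ht]
  · lift t to ℝ≥0 using ht
    rw [hk, integral_prod_symm _ (hint t)]
    have h3 := h2.setIntegral_eq (zero_le : (0 : ℝ≥0) ≤ t) MeasurableSet.univ
    simp only [setIntegral_univ, NNReal.coe_zero, intervalIntegral.integral_same, sub_zero] at h3
    rw [integral_sub (hfi t) (hGi t)] at h3
    have h4 : ∀ ω, stoppedAt X (fun _ => ∞) (t : ℝ) ω = X t ω := fun ω => by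
      rw [stoppedAt_of_lt (by simp)]; simp
    simp only [h4, h3, ← intervalIntegral.integral_of_le t.coe_nonneg]
    simp

/-- The Dynkin formula is preserved when the exponent decreases to zero. -/
lemma stoppedDynkin_zero_of_tendsto [IsProbabilityMeasure P] {φ : ℝ≥0∞ → ℝ≥0∞ → ℝ}
    (hφ : Measurable fun p : ℝ≥0∞ × ℝ≥0∞ => φ p.1 p.2)
    (hX : Measurable fun p : ℝ≥0 × Ω => X p.1 p.2) {σ : Ω → ℝ≥0∞} (hσ : Measurable σ)
    (h : ∀ k, StoppedDynkin (fun y => expKernel y (level k)) (fun y => φ (level k) y) X σ P)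
    {C : ℝ} (hC : ∀ (k : ℕ) (t : ℝ≥0) ω, (t : ℝ≥0∞) < σ ω → |φ (level k) (X t ω)| ≤ C)
    (hc : ∀ (t : ℝ≥0) ω, (t : ℝ≥0∞) < σ ω → ContinuousAt (fun x => φ x (X t ω)) 0) :
    StoppedDynkin (fun y => expKernel y 0) (fun y => φ 0 y) X σ P := by
  have hlim : ∀ p : ℝ × Ω, Tendsto (fun k => killed (fun y => φ (level k) y) X σ p) atTop
      (𝓝 (killed (fun y => φ 0 y) X σ p)) := by
    intro p
    unfold killed
    split_ifs with hp
    · exact (hc p.1.toNNReal p.2 hp).tendsto.comp tendsto_coe_level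
    · exact tendsto_const_nhds
  have hbd : ∀ k (p : ℝ × Ω), ‖killed (fun y => φ (level k) y) X σ p‖ ≤ max C 0 := by
    intro k p
    unfold killed
    split_ifs with hp
    · exact (hC k p.1.toNNReal p.2 hp).trans (le_max_left _ _)
    · simp
  have hm : ∀ x, Measurable (killed (fun y => φ x y) X σ) := fun x =>
    measurable_killed (hφ.comp (f := fun y => (x, y)) (by fun_prop)) hX hσ
  have he : ∀ Z : Ω → ℝ≥0∞, Measurable Z →
      Tendsto (fun k => ∫ ω, expKernel (Z ω) (level k) ∂P) atTop (𝓝 (∫ ω, expKernel (Z ω) 0 ∂P)) := by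
    intro Z hZ
    refine tendsto_integral_of_dominated_convergence (fun _ => 1)
      (fun k => (hZ.expKernel measurable_const).aestronglyMeasurable) (integrable_const _)
      (fun k => .of_forall fun ω => abs_expKernel_le_one _ _) (.of_forall fun ω => ?_)
    exact (continuousAt_expKernel_right (x := Z ω) (Or.inr ENNReal.zero_ne_top)).tendsto.comp
      tendsto_coe_level
  refine ⟨fun t => Integrable.of_bound (hm 0).aestronglyMeasurable (max C 0) (.of_forall fun p =>
    le_of_tendsto (hlim p).norm (.of_forall fun k => hbd k p)), fun t ht => ?_⟩
  have h1 := tendsto_integral_of_dominated_convergence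
    (μ := (volume.restrict (Ioc 0 t)).prod P) (fun _ => max C 0)
    (fun k => (hm (level k)).aestronglyMeasurable) (integrable_const _)
    (fun k => .of_forall fun p => hbd k p) (.of_forall hlim)
  simp only [fun k => (h k).integral_eq t ht] at h1
  refine tendsto_nhds_unique h1 ((he _ ?_).sub (he _ ?_))
  · exact (measurable_stoppedAt hX hσ).comp (f := fun ω => (t, ω)) (by fun_prop)
  · exact hX.comp (f := fun ω => ((0 : ℝ≥0), ω)) (by fun_prop)

end Solutions

/-! ### The duality -/

section Duality

variable {Ω Ω' : Type*} [MeasurableSpace Ω] [MeasurableSpace Ω'] {P : Measure Ω} {Q : Measure Ω'}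
  {X : ℝ≥0 → Ω → ℝ≥0∞} {Y : ℝ≥0 → Ω' → ℝ≥0∞}

lemma tendsto_dualityGap {Ω Ω' : Type*} {X : ℝ≥0 → Ω → ℝ≥0∞} {Y : ℝ≥0 → Ω' → ℝ≥0∞}
    {σ : ℕ → Ω → ℝ≥0∞} {τ : ℕ → Ω' → ℝ≥0∞} {x₀ y₀ : ℝ≥0∞} {s r : ℝ} {ω : Ω × Ω'} (c : ℝ)
    (hX : (∀ᶠ k in atTop, ENNReal.ofReal s < σ k ω.1) ∨ ((∀ k, σ k ω.1 ≤ ENNReal.ofReal s) ∧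
      Tendsto (fun k => expKernel (X (σ k ω.1).toNNReal ω.1) (Y r.toNNReal ω.2)) atTop (𝓝 c) ∧
      expKernel (X s.toNNReal ω.1) y₀ = c))
    (hY : (∀ᶠ k in atTop, ENNReal.ofReal r < τ k ω.2) ∨ ((∀ k, τ k ω.2 ≤ ENNReal.ofReal r) ∧
      Tendsto (fun k => expKernel (X s.toNNReal ω.1) (Y (τ k ω.2).toNNReal ω.2)) atTop (𝓝 c) ∧
      expKernel x₀ (Y r.toNNReal ω.2) = c)) :
    Tendsto (fun k => dualityGap X (σ k) x₀ Y (τ k) y₀ s r ω) atTop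
      (𝓝 (expKernel (X s.toNNReal ω.1) y₀ - expKernel x₀ (Y r.toNNReal ω.2))) := by
  rcases hX with hX | ⟨hX, hXc, hXe⟩ <;> rcases hY with hY | ⟨hY, hYc, hYe⟩
  · refine tendsto_const_nhds.congr' ?_
    filter_upwards [hX, hY] with k h1 h2
    rw [dualityGap, if_pos h1, if_pos h2, stoppedAt_of_lt h1, stoppedAt_of_lt h2]
    ring
  · rw [hYe]
    refine (hYc.const_sub (expKernel (X s.toNNReal ω.1) y₀)).congr' ?_
    filter_upwards [hX] with k h1
    rw [dualityGap, if_pos h1, if_neg (not_lt.2 (hY k)), stoppedAt_of_le (hY k)]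
    ring
  · rw [hXe]
    refine (hXc.sub_const (expKernel x₀ (Y r.toNNReal ω.2))).congr' ?_
    filter_upwards [hY] with k h2
    rw [dualityGap, if_pos h2, if_neg (not_lt.2 (hX k)), stoppedAt_of_le (hX k)]
    ring
  · rw [hXe, hYe, sub_self]
    refine tendsto_const_nhds.congr fun k => ?_
    rw [dualityGap, if_neg (not_lt.2 (hX k)), if_neg (not_lt.2 (hY k)), sub_zero]

lemma duality_of_start_top {A : Set ((ℝ≥0∞ → ℝ) × (ℝ≥0∞ → ℝ))}
    (hX : IsMPSolution A (Measure.dirac ∞) X P) (hp : ∀ ω, IsMinimalAt ∞ fun t => X t ω)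
    (Y : ℝ≥0 → Ω' → ℝ≥0∞) (Q : Measure Ω') (y₀ : ℝ≥0∞) (t : ℝ≥0) :
    ∫ ω, expKernel (X t ω) y₀ ∂P = ∫ ω, expKernel ∞ (Y t ω) ∂Q := by
  have : ∀ᵐ ω ∂P, expKernel (X t ω) y₀ = 0 := by
    filter_upwards [hX.ae_eq_of_start hp t] with ω hω
    rw [hω, expKernel_top_left]
  rw [integral_eq_zero_of_ae this]
  simp

variable [IsProbabilityMeasure P] [IsProbabilityMeasure Q] {ψ : ℝ≥0∞ → ℝ≥0∞ → ℝ} {x₀ y₀ : ℝ≥0∞}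

/-- Duality from localizing optional times. -/
lemma duality_of_localization (hψ : IsLaplaceDualSymbol ψ) (hv : VanishesAtInfinity ψ)
    (hX : IsMPSolution (pregenerator ψ) (Measure.dirac x₀) X P)
    (hXp : ∀ ω, IsMinimalAt ∞ fun t => X t ω)
    (hY : IsMPSolution (pregenerator (dual ψ)) (Measure.dirac y₀) Y Q)
    (hYp : ∀ ω, IsMinimalAt ∞ fun t => Y t ω)
    {σ : ℕ → Ω → ℝ≥0∞} {τ : ℕ → Ω' → ℝ≥0∞}
    (hσ : ∀ k, IsOptionalTime (Filtration.natural X hX.stronglyMeasurable) (σ k))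
    (hτ : ∀ k, IsOptionalTime (Filtration.natural Y hY.stronglyMeasurable) (τ k))
    (hY0 : ∀ k, ∀ᵐ q ∂(volume : Measure ℝ).prod Q, ENNReal.ofReal q.1 < τ k q.2 →
      Y q.1.toNNReal q.2 ≠ 0)
    (hX0 : ∀ k, ∀ᵐ p ∂(volume : Measure ℝ).prod P, ENNReal.ofReal p.1 < σ k p.2 →
      X p.1.toNNReal p.2 ≠ 0 ∨
        StoppedDynkin (fun y => expKernel y 0) (fun y => phi ψ 0 y) Y (τ k) Q)
    (hint : ∀ k, StoppedIntegrable (phi ψ) X (σ k) P Y (τ k) Q)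
    (hlim : ∀ s r : ℝ, 0 ≤ s → 0 ≤ r → ∀ᵐ ω ∂P.prod Q,
      Tendsto (fun k => dualityGap X (σ k) x₀ Y (τ k) y₀ s r ω) atTop
        (𝓝 (expKernel (X s.toNNReal ω.1) y₀ - expKernel x₀ (Y r.toNNReal ω.2)))) (t : ℝ≥0) :
    ∫ ω, expKernel (X t ω) y₀ ∂P = ∫ ω, expKernel x₀ (Y t ω) ∂Q := by
  refine duality_of_tendsto_dualityGap hX.measurable_uncurry hY.measurable_uncurry
    (fun k => (hσ k).measurable) (fun k => (hτ k).measurable)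
    (fun ω t => (hXp ω).continuousWithinAt_expKernel y₀ t)
    (fun ω t => (hYp ω).continuousWithinAt_expKernel x₀ t) (fun k T hT => ?_) hlim t
  refine integral_dualityGap_eq_zero hψ.measurable_phi hX.measurable_uncurry
    hY.measurable_uncurry (hσ k).measurable (hτ k).measurable hX.ae_zero_eq hY.ae_zero_eq ?_ ?_
    (hint k) hT
  · filter_upwards [hY0 k] with q hq h
    exact hX.stoppedDynkin hψ hv hXp (hσ k) (hq h)
  · filter_upwards [hX0 k] with p hp h
    rcases eq_or_ne (X p.1.toNNReal p.2) 0 with h0 | h0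
    · rw [h0]
      exact (hp h).resolve_left (by simp [h0])
    · exact hY.stoppedDynkin_dual hψ hv hYp (hτ k) h0

lemma duality_of_integrable (hψ : IsLaplaceDualSymbol ψ) (hv : VanishesAtInfinity ψ)
    (hX : IsMPSolution (pregenerator ψ) (Measure.dirac x₀) X P)
    (hXp : ∀ ω, IsMinimalAt ∞ fun t => X t ω)
    (hY : IsMPSolution (pregenerator (dual ψ)) (Measure.dirac y₀) Y Q)
    (hYp : ∀ ω, IsMinimalAt ∞ fun t => Y t ω)
    (hint : StoppedIntegrable (phi ψ) X (fun _ => ∞) P Y (fun _ => ∞) Q)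
    (hind : IsIntegralMartingale (fun y => if y < ∞ then 1 else 0) (fun y => phi ψ 0 y) Y
      hY.stronglyMeasurable Q)
    (hY0 : NonSticky 0 y₀ Y Q) (hy₀ : 0 < y₀) (t : ℝ≥0) :
    ∫ ω, expKernel (X t ω) y₀ ∂P = ∫ ω, expKernel x₀ (Y t ω) ∂Q := by
  have hne := hY0 hy₀.ne'
  refine duality_of_localization hψ hv hX hXp hY hYp (σ := fun _ _ => ∞) (τ := fun _ _ => ∞)
    (fun _ => isOptionalTime_top _) (fun _ => isOptionalTime_top _)
    (fun k => (ae_prod_ne hY.measurable_uncurry hne).mono fun q hq _ => hq)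
    (fun k => .of_forall fun p _ => Or.inr
      (stoppedDynkin_indicator hψ hY.stronglyMeasurable hY.measurable_uncurry hind hne))
    (fun _ => hint) (fun s r _ _ => .of_forall fun ω => ?_) t
  exact tendsto_dualityGap 0 (Or.inl (by simp)) (Or.inl (by simp))

lemma duality_of_passageAbove (hψ : IsLaplaceDualSymbol ψ) (hv : VanishesAtInfinity ψ)
    (hX : IsMPSolution (pregenerator ψ) (Measure.dirac x₀) X P)
    (hXp : ∀ ω, IsMinimalAt ∞ fun t => X t ω)
    (hY : IsMPSolution (pregenerator (dual ψ)) (Measure.dirac y₀) Y Q)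
    (hYp : ∀ ω, IsMinimalAt ∞ fun t => Y t ω)
    (hint : ∀ m : ℕ, 1 ≤ m → StoppedIntegrable (phi ψ)
      X (fun ω => passageAbove m fun t => X t ω) P Y (fun ω => passageAbove m fun t => Y t ω) Q)
    (hX0 : NonSticky 0 x₀ X P) (hY0 : NonSticky 0 y₀ Y Q) (hx₀ : 0 < x₀) (hy₀ : 0 < y₀)
    (t : ℝ≥0) :
    ∫ ω, expKernel (X t ω) y₀ ∂P = ∫ ω, expKernel x₀ (Y t ω) ∂Q := by
  have hXne := hX0 hx₀.ne'
  have hYne := hY0 hy₀.ne'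
  refine duality_of_localization hψ hv hX hXp hY hYp
    (σ := fun k ω => passageAbove (k + 1 : ℕ) fun t => X t ω)
    (τ := fun k ω => passageAbove (k + 1 : ℕ) fun t => Y t ω)
    (fun k => isOptionalTime_hitTime _ (fun ω t => ((hXp ω).1 t).1) isOpen_Ioi)
    (fun k => isOptionalTime_hitTime _ (fun ω t => ((hYp ω).1 t).1) isOpen_Ioi)
    (fun k => (ae_prod_ne hY.measurable_uncurry hYne).mono fun q hq _ => hq)
    (fun k => (ae_prod_ne hX.measurable_uncurry hXne).mono fun q hq _ => Or.inl hq)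
    (fun k => hint _ k.succ_pos) (fun s r _ _ => ?_) t
  filter_upwards [Measure.quasiMeasurePreserving_fst.ae (hXne s.toNNReal),
    Measure.quasiMeasurePreserving_snd.ae (hYne r.toNNReal)] with ω hx hy
  refine tendsto_dualityGap 0 ((passageAbove_alternative (hXp ω.1) s.toNNReal).imp id ?_)
    ((passageAbove_alternative (hYp ω.2) r.toNNReal).imp id ?_)
  · rintro ⟨h1, h2, h3⟩
    refine ⟨h1, ?_, by rw [h3, expKernel_top_left]⟩
    have := (continuousAt_expKernel_left (x := ∞) (Or.inl hy)).tendsto.comp h2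
    rwa [expKernel_top_left] at this
  · rintro ⟨h1, h2, h3⟩
    refine ⟨h1, ?_, by rw [h3, expKernel_top_right]⟩
    have := (continuousAt_expKernel_right (y := ∞) (Or.inl hx)).tendsto.comp h2
    rwa [expKernel_top_right] at this

lemma duality_of_passageBelow (hψ : IsLaplaceDualSymbol ψ) (hv : VanishesAtInfinity ψ)
    (hX : IsMPSolution (pregenerator ψ) (Measure.dirac x₀) X P)
    (hXp : ∀ ω, IsMinimalAt ∞ fun t => X t ω)
    (hY : IsMPSolution (pregenerator (dual ψ)) (Measure.dirac y₀) Y Q)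
    (hYp : ∀ ω, IsMinimalAt ∞ fun t => Y t ω)
    (hint : ∀ ε : ℝ≥0, 0 < ε → StoppedIntegrable (phi ψ)
      X (fun ω => passageBelow ε fun t => X t ω) P Y (fun ω => passageBelow ε fun t => Y t ω) Q)
    (hXm : ∀ ω, IsMinimalAt 0 fun t => X t ω) (hYm : ∀ ω, IsMinimalAt 0 fun t => Y t ω)
    (hX0 : NonSticky ∞ x₀ X P) (hY0 : NonSticky ∞ y₀ Y Q) (t : ℝ≥0) :
    ∫ ω, expKernel (X t ω) y₀ ∂P = ∫ ω, expKernel x₀ (Y t ω) ∂Q := by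
  rcases eq_or_ne x₀ ∞ with rfl | hx₀
  · exact duality_of_start_top hX hXp Y Q y₀ t
  rcases eq_or_ne y₀ ∞ with rfl | hy₀
  · simpa only [expKernel_comm x₀, expKernel_comm ∞] using
      (duality_of_start_top hY hYp X P x₀ t).symm
  have hXne := hX0 hx₀
  have hYne := hY0 hy₀
  have hpos : ∀ k, (level k : ℝ≥0∞) ≠ 0 := fun k => by exact_mod_cast (level_pos k).ne'
  refine duality_of_localization hψ hv hX hXp hY hYp
    (σ := fun k ω => passageBelow (level k) fun t => X t ω)
    (τ := fun k ω => passageBelow (level k) fun t => Y t ω)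
    (fun k => isOptionalTime_hitTime _ (fun ω t => ((hXp ω).1 t).1) isOpen_Iio)
    (fun k => isOptionalTime_hitTime _ (fun ω t => ((hYp ω).1 t).1) isOpen_Iio)
    (fun k => .of_forall fun q hq => ?_) (fun k => .of_forall fun q hq => Or.inl ?_)
    (fun k => hint _ (level_pos k)) (fun s r _ _ => ?_) t
  · exact ne_of_gt ((pos_iff_ne_zero.2 (hpos k)).trans_le
      (le_of_lt_passageBelow (f := fun t => Y t q.2) (t := q.1.toNNReal) hq))
  · exact ne_of_gt ((pos_iff_ne_zero.2 (hpos k)).trans_le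
      (le_of_lt_passageBelow (f := fun t => X t q.2) (t := q.1.toNNReal) hq))
  filter_upwards [Measure.quasiMeasurePreserving_fst.ae (hXne s.toNNReal),
    Measure.quasiMeasurePreserving_snd.ae (hYne r.toNNReal)] with ω hx hy
  refine tendsto_dualityGap 1 ((passageBelow_alternative (hXm ω.1) s.toNNReal).imp id ?_)
    ((passageBelow_alternative (hYm ω.2) r.toNNReal).imp id ?_)
  · rintro ⟨h1, h2, h3⟩
    refine ⟨h1, ?_, by rw [h3, expKernel_zero_left hy₀]⟩
    have := (continuousAt_expKernel_left (x := 0) (y := Y r.toNNReal ω.2)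
      (Or.inr ENNReal.zero_ne_top)).tendsto.comp h2
    rwa [expKernel_zero_left hy] at this
  · rintro ⟨h1, h2, h3⟩
    refine ⟨h1, ?_, by rw [h3, expKernel_zero_right hx₀]⟩
    have := (continuousAt_expKernel_right (x := X s.toNNReal ω.1) (y := 0)
      (Or.inr ENNReal.zero_ne_top)).tendsto.comp h2
    rwa [expKernel_zero_right hx] at this

lemma duality_of_exit (hψ : IsLaplaceDualSymbol ψ) (hv : VanishesAtInfinity ψ)
    (hX : IsMPSolution (pregenerator ψ) (Measure.dirac x₀) X P)
    (hXp : ∀ ω, IsMinimalAt ∞ fun t => X t ω)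
    (hY : IsMPSolution (pregenerator (dual ψ)) (Measure.dirac y₀) Y Q)
    (hYp : ∀ ω, IsMinimalAt ∞ fun t => Y t ω)
    (hint : ∀ (n : ℕ) (ε : ℝ≥0), 1 ≤ n → 0 < ε → StoppedIntegrable (phi ψ) X (fun _ => ∞) P Y
      (fun ω => min (passageAbove n fun t => Y t ω) (passageBelow ε fun t => Y t ω)) Q)
    (hcont : ContAtZero (dual (phi ψ))) (hbd : BoundedOnStrips (phi ψ))
    (hX0 : NonSticky ∞ x₀ X P) (hne : ∀ᵐ ω ∂Q, NoContinuousExplosion fun t => Y t ω)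
    (hYm : ∀ ω, IsMinimalAt 0 fun t => Y t ω) (t : ℝ≥0) :
    ∫ ω, expKernel (X t ω) y₀ ∂P = ∫ ω, expKernel x₀ (Y t ω) ∂Q := by
  rcases eq_or_ne x₀ ∞ with rfl | hx₀
  · exact duality_of_start_top hX hXp Y Q y₀ t
  have hXne := hX0 hx₀
  have hpos : ∀ k, (level k : ℝ≥0∞) ≠ 0 := fun k => by exact_mod_cast (level_pos k).ne'
  have hτ : ∀ k : ℕ, IsOptionalTime (Filtration.natural Y hY.stronglyMeasurable) fun ω =>
      min (passageAbove (k + 1 : ℕ) fun t => Y t ω) (passageBelow (level k) fun t => Y t ω) :=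
    fun k => (isOptionalTime_hitTime _ (fun ω t => ((hYp ω).1 t).1) isOpen_Ioi).min
      (isOptionalTime_hitTime _ (fun ω t => ((hYp ω).1 t).1) isOpen_Iio)
  refine duality_of_localization hψ hv hX hXp hY hYp (σ := fun _ _ => ∞)
    (τ := fun k ω => min (passageAbove (k + 1 : ℕ) fun t => Y t ω)
      (passageBelow (level k) fun t => Y t ω))
    (fun k => isOptionalTime_top _) hτ
    (fun k => .of_forall fun q hq => ?_) (fun k => .of_forall fun q hq => Or.inr ?_)
    (fun k => hint _ _ k.succ_pos (level_pos k)) (fun s r _ _ => ?_) t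
  · exact ne_of_gt ((pos_iff_ne_zero.2 (hpos k)).trans_le (le_of_lt_passageBelow
      (f := fun t => Y t q.2) (t := q.1.toNNReal) (hq.trans_le (min_le_right _ _))))
  · obtain ⟨C, hC⟩ := hbd 1 (k + 2) (level k / 2) one_pos (by positivity)
      (half_pos (level_pos k))
    refine stoppedDynkin_zero_of_tendsto hψ.measurable_phi hY.measurable_uncurry
      (hτ k).measurable (fun j => hY.stoppedDynkin_dual hψ hv hYp (hτ k) (hpos j)) (C := C)
      (fun j t ω ht => hC _ _ ?_ ?_ ?_) (fun t ω ht => hcont _ ?_)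
    · have : level j ≤ 1 := inv_le_one_of_one_le₀ (by simp)
      exact_mod_cast this
    · refine lt_of_lt_of_le ?_ (le_of_lt_passageBelow (f := fun t => Y t ω) (t := t)
        (ht.trans_le (min_le_right _ _)))
      exact_mod_cast half_lt_self (level_pos k)
    · refine lt_of_le_of_lt (le_of_lt_passageAbove (f := fun t => Y t ω) (t := t)
        (ht.trans_le (min_le_left _ _))) ?_
      have : ((k + 1 : ℕ) : ℝ≥0) < (k : ℝ≥0) + 2 := by
        push_cast
        gcongr
        norm_num
      exact_mod_cast this
    · exact lt_of_le_of_lt (le_of_lt_passageAbove (f := fun t => Y t ω) (t := t)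
        (ht.trans_le (min_le_left _ _))) (ENNReal.natCast_lt_top _)
  filter_upwards [Measure.quasiMeasurePreserving_fst.ae (hXne s.toNNReal),
    Measure.quasiMeasurePreserving_snd.ae hne] with ω hx hy
  refine tendsto_dualityGap (expKernel x₀ (Y r.toNNReal ω.2)) (Or.inl (by simp))
    ((exit_alternative (hYp ω.2) (hYm ω.2) hy r.toNNReal).imp id ?_)
  rintro ⟨h1, h2⟩
  refine ⟨h1, ?_, rfl⟩
  rcases h2 with ⟨h2, h3⟩ | ⟨h2, h3⟩
  · have := (continuousAt_expKernel_right (x := X s.toNNReal ω.1) (y := 0)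
      (Or.inr ENNReal.zero_ne_top)).tendsto.comp h2
    rw [expKernel_zero_right hx] at this
    rwa [h3, expKernel_zero_right hx₀]
  · rw [h3, expKernel_top_right]
    refine tendsto_const_nhds.congr' ?_
    filter_upwards [h2] with k hk
    rw [hk, expKernel_top_right]

end Duality

end LaplaceDuality

end

theorem mainTheorem4
    {Ω Ω' : Type*} [MeasurableSpace Ω] [MeasurableSpace Ω']
    (ψ : ℝ≥0∞ → ℝ≥0∞ → ℝ) (hψ : IsLaplaceDualSymbol ψ) (hψ_inf : VanishesAtInfinity ψ)
    (x₀ y₀ : ℝ≥0∞)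
    (P : Measure Ω) [IsProbabilityMeasure P] (Q : Measure Ω') [IsProbabilityMeasure Q]
    (X : ℝ≥0 → Ω → ℝ≥0∞) (Y : ℝ≥0 → Ω' → ℝ≥0∞)
    (hX : IsMPSolution (pregenerator ψ) (Measure.dirac x₀) X P)
    (hX_path : ∀ ω, IsMinimalAt ∞ fun t => X t ω)
    (hY : IsMPSolution (pregenerator (dual ψ)) (Measure.dirac y₀) Y Q)
    (hY_path : ∀ ω, IsMinimalAt ∞ fun t => Y t ω)
    (hcond :
      -- (I)
      (StoppedIntegrable (phi ψ) X (fun _ => ∞) P Y (fun _ => ∞) Q ∧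
        IsIntegralMartingale (fun y => if y < ∞ then 1 else 0) (fun y => phi ψ 0 y) Y
          hY.stronglyMeasurable Q ∧
        NonSticky 0 y₀ Y Q ∧ 0 < y₀) ∨
      -- (II)
      ((∀ m n : ℕ, 1 ≤ m → 1 ≤ n →
          StoppedIntegrable (phi ψ) X (fun ω => passageAbove m fun t => X t ω) P
              Y (fun ω => passageAbove n fun t => Y t ω) Q ∧
            TerminalIntegrable (phi ψ) X (fun ω => passageAbove m fun t => X t ω) P
              Y (fun ω => passageAbove n fun t => Y t ω) Q) ∧
        TendsToZeroAtInfinity (phi ψ) ∧ TendsToZeroAtInfinity (dual (phi ψ)) ∧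
        NonSticky 0 x₀ X P ∧ NonSticky 0 y₀ Y Q ∧ 0 < x₀ ∧ 0 < y₀) ∨
      -- (III)
      ((∀ (n : ℕ) (ε : ℝ≥0), 1 ≤ n → 0 < ε →
          StoppedIntegrable (phi ψ) X (fun _ => ∞) P Y
            (fun ω => min (passageAbove n fun t => Y t ω) (passageBelow ε fun t => Y t ω)) Q) ∧
        ContAtZero (dual (phi ψ)) ∧ BoundedOnStrips (phi ψ) ∧ VanishesAtZero (dual (phi ψ)) ∧
        NonSticky ∞ x₀ X P ∧ (∀ᵐ ω ∂Q, NoContinuousExplosion fun t => Y t ω) ∧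
        (∀ ω, IsMinimalAt 0 fun t => Y t ω)) ∨
      -- (IV)
      ((∀ δ ε : ℝ≥0, 0 < δ → 0 < ε →
          StoppedIntegrable (phi ψ) X (fun ω => passageBelow δ fun t => X t ω) P
              Y (fun ω => passageBelow ε fun t => Y t ω) Q ∧
            TerminalIntegrable (phi ψ) X (fun ω => passageBelow δ fun t => X t ω) P
              Y (fun ω => passageBelow ε fun t => Y t ω) Q) ∧
        ContAtZero (phi ψ) ∧ ContAtZero (dual (phi ψ)) ∧ BoundedOnSquares (phi ψ) ∧
        VanishesAtZero (phi ψ) ∧ VanishesAtZero (dual (phi ψ)) ∧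
        (∀ ω, IsMinimalAt 0 fun t => X t ω) ∧ (∀ ω, IsMinimalAt 0 fun t => Y t ω) ∧
        NonSticky ∞ x₀ X P ∧ NonSticky ∞ y₀ Y Q)) :
    ∀ t : ℝ≥0, ∫ ω, expKernel (X t ω) y₀ ∂P = ∫ ω, expKernel x₀ (Y t ω) ∂Q := by
  intro t
  rcases hcond with ⟨h1, h2, h3, h4⟩ | ⟨h1, -, -, h2, h3, h4, h5⟩ | ⟨h1, h2, h3, -, h4, h5, h6⟩ |
    ⟨h1, -, -, -, -, -, h2, h3, h4, h5⟩
  · exact duality_of_integrable hψ hψ_inf hX hX_path hY hY_path h1 h2 h3 h4 t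
  · exact duality_of_passageAbove hψ hψ_inf hX hX_path hY hY_path
      (fun m hm => (h1 m m hm hm).1) h2 h3 h4 h5 t
  · exact duality_of_exit hψ hψ_inf hX hX_path hY hY_path h1 h2 h3 h4 h5 h6 t
  · exact duality_of_passageBelow hψ hψ_inf hX hX_path hY hY_path
      (fun ε hε => (h1 ε ε hε hε).1) h2 h3 h4 h5 t
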